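/- Let $k=\mathbb F_q$ be a finite field, let $r\ge 2$ and let $X=(\mathbb P^1)^r$ over $k$, with homogeneous coordinates $[X_i:Z_i]$ on the $i$-th factor. Let $E_i=V(Z_i)$, let $m_1,\dots,m_r$ be integers with $0\le m_i<q-2$, put $G=\sum_{i=1}^r m_iE_i$, and let $\mathcal P=\{P_1,\dots,P_n\}$, $n=q^r$, be the set of all $k$-rational points of the affine chart $\bigcap_i\{Z_i\ne 0\}$. For a divisor $G'$ on $X$ (always defined over $k$) whose support is disjoint from $\mathcal P$, the functional code $C_L(\mathcal P,G')\subseteq k^n$ is the image of $L(G')=\{f\in k(X)^*: (f)+G'\ge 0\}\cup\{0\}$ under $f\mapsto (f(P_1),\dots,f(P_n))$. A strictly rectified differential code over $\mathcal P$ is defined as follows. Let $G'$ be as above, let $\mathcal D=\{D_1,\dots,D_r\}$ be properly intersecting effective divisors on $X$ with $\mathcal P\subseteq\bigcap_l D_l$ (set-theoretically). At each point $P\in\bigcap_l D_l$ let $f_1,\dots,f_r$ be local equations of $D_1,\dots,D_r$, let $x_1,\dots,x_r$ generate the maximal ideal of $\mathcal O_P$, let $a>0$ and $r_{ij}\in\mathcal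 O_P$ be such that $x_i^a=\sum_j r_{ij}f_j$ for all $i$, and put $R_P=\det[r_{ij}]$. A function $\theta\in k(X)^*$, regular at all points of $\bigcap_l D_l$, is strictly $(\mathcal D,\mathcal P)$-rectifying if $R_P\theta\equiv c_P\,x_1^{a-1}\cdots x_r^{a-1} \pmod{(x_1^a,\dots,x_r^a)}$ with $c_P\in k^*$ for $P\in\mathcal P$, and $R_P\theta\equiv 0\pmod{(x_1^a,\dots,x_r^a)}$ for the other points $P$ of $\bigcap_l D_l$. For such $\theta$ the code is the image in $k^n$ of $$\Omega^r\Big(\sum_l D_l-G'-(\theta)^+\Big)=\Big\{0\ne\omega\in\Omega^r(X):(\omega)+\sum_l D_l-G'-(\theta)^+\ge 0\Big\}\cup\{0\},$$ where $\Omega^r(X)$ is the space of rational $r$-differentials on $X$ over $k$ and $(\theta)^+$ is the divisor of zeros of $\theta$, under the map whose component at $P\in\mathcal P$ sends $\omega$ to the Grothendieck residue of $\omega$ relative to $D_1,\dots,D_r$, i.e. to the coefficient of $x_1^{a-1}\cdots x_r^{a-1}$ in the power series expansion of $R_P h$ in $x_1,\dots,x_r$, where $f_1\cdots f_r\,\omega=h\,dx_1\wedge\dots\wedge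 dx_r$. (Neither notion depends on the choices of $f_l$, $x_i$, $a$, $r_{ij}$.) Then the dual $C_L(\mathcal P,G)^\perp$ with respect to the standard dot product on $k^n$ is not a functional code: there is no divisor $G'$ on $X$ with support disjoint from $\mathcal P$ such that $C_L(\mathcal P,G)^\perp=C_L(\mathcal P,G')$. Likewise, $C_L(\mathcal P,G)^\perp$ is not a strictly rectified differential code over $\mathcal P$. -/

import Mathlib

open scoped Matrix

namespace RectifiedCodes

/-!
An integral separated scheme of finite type over a field `k` with function field `K` is described
here by the set `X` of its local rings `O_P ⊆ K`, where `P` runs through all scheme-theoretic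
points (by separatedness, a point is determined by its local ring). A point `P` lies in the closure
of a point `Y` if and only if `O_P ⊆ O_Y`. If `X` is smooth, its prime divisors are the points whose
local ring is a discrete valuation ring.
-/

section Variety

variable {K : Type*} [Field K]

/-- A prime divisor of the smooth variety with set of local rings `X`, given by its local ring. -/
structure PrimeDivisor (X : Set (LocalSubring K)) where
  /-- the local ring at the generic point of the prime divisor -/
  ring : ValuationSubring K
  isDVR : IsDiscreteValuationRing ring
  mem : ring.toLocalSubring ∈ X

attribute [instance] PrimeDivisor.isDVR

variable {X : Set (LocalSubring K)}

/-- The order of vanishing of `f ≠ 0` along `Y` (and `0` for `f = 0`). -/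
noncomputable def PrimeDivisor.ord (Y : PrimeDivisor X) (f : K) : ℤ :=
  WithZero.log (Ring.ordFrac Y.ring f)

/-- The point with local ring `P` lies on the prime divisor `Y`. -/
def PrimeDivisor.Through (Y : PrimeDivisor X) (P : LocalSubring K) : Prop :=
  P.toSubring ≤ Y.ring.toSubring

/-- Divisors on `X`: the finite formal integral combinations of prime divisors. -/
abbrev Divisor (X : Set (LocalSubring K)) := PrimeDivisor X →₀ ℤ

/-- The point `P` lies in the support of the divisor `G`. -/
def InSupport (G : Divisor X) (P : LocalSubring K) : Prop :=
  ∃ Y : PrimeDivisor X, G Y ≠ 0 ∧ Y.Through P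

/-- The Riemann-Roch space `L(W) = {f | (f) + W ≥ 0} ∪ {0}`. -/
def rrSpace (W : PrimeDivisor X → ℤ) : Set K :=
  {f | f = 0 ∨ ∀ Y : PrimeDivisor X, 0 ≤ Y.ord f + W Y}

/-- The points of `X` in the set-theoretic intersection of the supports of `D_1, …, D_r`. -/
def inter {r : ℕ} (D : Fin r → Divisor X) : Set (LocalSubring K) :=
  {P | P ∈ X ∧ ∀ l, InSupport (D l) P}

/-- The divisors `D_1, …, D_r` are effective and intersect properly: every point of the
intersection of their supports has codimension `r` in `X`. -/
def ProperlyIntersecting {r : ℕ} (D : Fin r → Divisor X) : Prop :=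
  (∀ l Y, 0 ≤ D l Y) ∧ ∀ P ∈ inter D, ringKrullDim P.toSubring = r

/-- The auxiliary choices at a point `P`: local equations `f_l` of the `D_l`, generators
`x_1, …, x_r` of the maximal ideal, an exponent `a > 0` and a matrix `[r_ij]` over `O_P` with
`x_i ^ a = ∑ j, r_ij f_j`. -/
structure LocalChoice {r : ℕ} (D : Fin r → Divisor X) (P : LocalSubring K) where
  f : Fin r → P.toSubring
  f_ne_zero : ∀ l, f l ≠ 0
  ord_f : ∀ l (Y : PrimeDivisor X), Y.Through P → Y.ord (f l : K) = D l Y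
  x : Fin r → P.toSubring
  span_x : Ideal.span (Set.range x) = IsLocalRing.maximalIdeal P.toSubring
  a : ℕ
  a_pos : 0 < a
  mat : Matrix (Fin r) (Fin r) P.toSubring
  x_pow : ∀ i, x i ^ a = ∑ j, mat i j * f j

/-- The ideal `(x_1 ^ a, …, x_r ^ a)` of `O_P`. -/
def LocalChoice.powIdeal {r : ℕ} {D : Fin r → Divisor X} {P : LocalSubring K}
    (F : LocalChoice D P) : Ideal P.toSubring :=
  Ideal.span (Set.range fun i => F.x i ^ F.a)

section OverField

variable (k : Type*) [Field k] [Algebra k K]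

/-- `f` is regular at `P` and its value at `P` is the scalar `c`. -/
def HasValue (P : LocalSubring K) (f : K) (c : k) : Prop :=
  ∃ z ∈ IsLocalRing.maximalIdeal P.toSubring, f - algebraMap k K c = (z : K)

/-- `dx_1 ∧ ⋯ ∧ dx_r` as a rational `r`-differential of `X` over `k`. -/
noncomputable def wedgeD {r : ℕ} (x : Fin r → K) : ⋀[K]^r (Ω[K⁄k]) :=
  exteriorPower.ιMulti K r fun i => KaehlerDifferential.D k K (x i)

/-- The rational `r`-differentials that are regular at the point with local ring `A`. -/
noncomputable def regularForms (r : ℕ) (A : Subring K) : Submodule A (⋀[K]^r (Ω[K⁄k])) :=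
  Submodule.span A (Set.range fun b : Fin r → A => wedgeD k fun i => (b i : K))

/-- The space `Ω^r(W) = {ω | (ω) + W ≥ 0} ∪ {0}`: for every prime divisor `Y`, the product of `ω`
with a rational function of order `W Y` along `Y` is regular at the generic point of `Y`. -/
def formSpace (r : ℕ) (W : PrimeDivisor X → ℤ) : Set (⋀[K]^r (Ω[K⁄k])) :=
  {ω | ∀ Y : PrimeDivisor X, ∃ g : K, g ≠ 0 ∧ Y.ord g = W Y ∧
    g • ω ∈ regularForms k r Y.ring.toSubring}

/-- `S` is the power series expansion of `h ∈ O_P` in the generators `x_1, …, x_r` of the maximal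
ideal: for every `n`, `h` agrees modulo the `n`-th power of the maximal ideal with the value at `x`
of any polynomial that has the same coefficients as `S` in degrees less than `n`. -/
def HasExpansion {r : ℕ} {P : LocalSubring K} (x : Fin r → P.toSubring) (h : P.toSubring)
    (S : MvPowerSeries (Fin r) k) : Prop :=
  ∀ (n : ℕ) (p : MvPolynomial (Fin r) k),
    (∀ I : Fin r →₀ ℕ, I.degree < n → p.coeff I = MvPowerSeries.coeff I S) →
    ∃ z ∈ IsLocalRing.maximalIdeal P.toSubring ^ n,
      (h : K) - MvPolynomial.aeval (fun i => (x i : K)) p = (z : K)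

/-- The Grothendieck residue of `ω` at the `k`-rational point `P` relative to `D_1, …, D_r` is `c`:
if `f_1 ⋯ f_r ω = h dx_1 ∧ ⋯ ∧ dx_r` with `h ∈ O_P`, then `c` is the coefficient of
`(x_1 ⋯ x_r) ^ (a - 1)` in the expansion of `det [r_ij] h`. -/
def HasResidue {r : ℕ} {D : Fin r → Divisor X} {P : LocalSubring K} (F : LocalChoice D P)
    (ω : ⋀[K]^r (Ω[K⁄k])) (c : k) : Prop :=
  ∃ h : P.toSubring,
    (∏ l, (F.f l : K)) • ω = (h : K) • wedgeD k (fun i => (F.x i : K)) ∧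
    ∃ S : MvPowerSeries (Fin r) k, HasExpansion k F.x (F.mat.det * h) S ∧
      MvPowerSeries.coeff (Finsupp.equivFunOnFinite.symm fun _ => F.a - 1) S = c

variable {ι : Type*} [Fintype ι]

/-- The functional code `C_L(𝒫, G)`, where `𝒫` is the family `pts` of rational points. -/
def functionalCode (pts : ι → LocalSubring K) (G : Divisor X) : Set (ι → k) :=
  {v | ∃ f ∈ rrSpace (G : PrimeDivisor X → ℤ), ∀ i, HasValue k (pts i) f (v i)}

/-- `C` is a functional code on `X` over the points `pts`. -/
def IsFunctionalCode (X : Set (LocalSubring K)) (pts : ι → LocalSubring K)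
    (C : Set (ι → k)) : Prop :=
  ∃ G : Divisor X, (∀ i, ¬ InSupport G (pts i)) ∧ C = functionalCode k pts G

/-- `θ` is strictly `(𝒟, 𝒫)`-rectifying. -/
def StrictlyRectifying {r : ℕ} (pts : ι → LocalSubring K) {D : Fin r → Divisor X}
    (F : ∀ P : inter D, LocalChoice D P.1) (θ : K) : Prop :=
  θ ≠ 0 ∧ (∀ P : inter D, θ ∈ P.1.toSubring) ∧
  (∀ P : inter D, P.1 ∈ Set.range pts → ∃ c : k, c ≠ 0 ∧ ∃ z ∈ (F P).powIdeal,
    ((F P).mat.det : K) * θ - algebraMap k K c * ∏ j, ((F P).x j : K) ^ ((F P).a - 1) = (z : K)) ∧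
  (∀ P : inter D, P.1 ∉ Set.range pts → ∃ z ∈ (F P).powIdeal,
    ((F P).mat.det : K) * θ = (z : K))

/-- The differential code `C_Ω(𝒟, 𝒫, θ, G)`: the image under the residues at the points of `𝒫` of
`Ω^r(∑ D_l - G - (θ)⁺)`. -/
def differentialCode {r : ℕ} (pts : ι → LocalSubring K) {D : Fin r → Divisor X}
    (hpts : ∀ i, pts i ∈ inter D) (F : ∀ P : inter D, LocalChoice D P.1) (θ : K)
    (G : Divisor X) : Set (ι → k) :=
  {v | ∃ ω ∈ formSpace (X := X) k r (fun Y => ∑ l, D l Y - G Y - max (Y.ord θ) 0),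
    ∀ i, HasResidue k (F ⟨pts i, hpts i⟩) ω (v i)}

/-- `C` is a strictly rectified differential code on the `r`-dimensional variety `X` over the points
`pts`. Neither the rectifying condition nor the residues depend on the auxiliary choices `F`. -/
def IsStrictlyRectifiedCode (r : ℕ) (X : Set (LocalSubring K)) (pts : ι → LocalSubring K)
    (C : Set (ι → k)) : Prop :=
  ∃ (G : Divisor X) (D : Fin r → Divisor X) (hpts : ∀ i, pts i ∈ inter D)
    (F : ∀ P : inter D, LocalChoice D P.1) (θ : K),
    (∀ i, ¬ InSupport G (pts i)) ∧ ProperlyIntersecting D ∧ StrictlyRectifying k pts F θ ∧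
    C = differentialCode k pts hpts F θ G

variable {k}

/-- The dual of a code with respect to the standard dot product. -/
def dualCode (C : Set (ι → k)) : Set (ι → k) :=
  {v | ∀ c ∈ C, c ⬝ᵥ v = 0}

end OverField

end Variety

section ProductOfLines

/-- The localization of a Noetherian domain at a nonzero principal prime is a discrete valuation
ring. -/
theorem isDVR_ofPrime {K : Type*} [Field K] (A : Subring K) [IsNoetherianRing A] (p : Ideal A)
    [p.IsPrime] (y : A) (hy : y ≠ 0) (hp : p = Ideal.span {y}) :
    IsDiscreteValuationRing (LocalSubring.ofPrime A p).toSubring := by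
  have hO : IsNoetherianRing (LocalSubring.ofPrime A p).toSubring :=
    IsLocalization.isNoetherianRing p.primeCompl _ inferInstance
  have hm : IsLocalRing.maximalIdeal (LocalSubring.ofPrime A p).toSubring =
      Ideal.span {algebraMap A (LocalSubring.ofPrime A p).toSubring y} := by
    rw [← IsLocalization.AtPrime.map_eq_maximalIdeal p, ← Set.image_singleton, ← Ideal.map_span]
    exact congrArg _ hp
  have hne : algebraMap A (LocalSubring.ofPrime A p).toSubring y ≠ 0 := fun h =>
    hy (Subtype.ext (congrArg
      (Subtype.val : (LocalSubring.ofPrime A p).toSubring → K) h))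
  have hf : ¬ IsField (LocalSubring.ofPrime A p).toSubring := by
    rw [IsLocalRing.isField_iff_maximalIdeal_eq, hm, Ideal.span_singleton_eq_bot]
    exact hne
  refine ((IsDiscreteValuationRing.TFAE _ hf).out 0 4).2 ?_
  rw [hm]
  exact ⟨⟨_, rfl⟩⟩

variable (k : Type*) [Field k] (r : ℕ)

/-- The function field `k(x_1, …, x_r)` of `(ℙ¹)^r`, with `x_i = X_i / Z_i`. -/
abbrev FunField := FractionRing (MvPolynomial (Fin r) k)

variable {r}

/-- The coordinate `x_i = X_i / Z_i`. -/
noncomputable def coord (i : Fin r) : FunField k r :=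
  algebraMap (MvPolynomial (Fin r) k) (FunField k r) (MvPolynomial.X i)

/-- The coordinates of the standard affine chart of `(ℙ¹)^r` indexed by `s`: `Z_i / X_i` if `s i`
is true and `X_i / Z_i` otherwise. -/
noncomputable def chartCoord (s : Fin r → Bool) (i : Fin r) : FunField k r :=
  if s i then (coord k i)⁻¹ else coord k i

/-- The coordinate ring of the chart indexed by `s`. -/
noncomputable def chart (s : Fin r → Bool) : Subalgebra k (FunField k r) :=
  Algebra.adjoin k (Set.range (chartCoord k s))

variable (r)

/-- `(ℙ¹)^r` over `k`: the local rings at all prime ideals of its `2 ^ r` standard affine charts. -/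
def P1Pow : Set (LocalSubring (FunField k r)) :=
  {P | ∃ (s : Fin r → Bool) (p : PrimeSpectrum (chart k s).toSubring),
    P = LocalSubring.ofPrime (chart k s).toSubring p.asIdeal}

variable {r}

theorem algebraicIndependent_chartCoord (s : Fin r → Bool) :
    AlgebraicIndependent k (chartCoord k s) := by
  have hx : AlgebraicIndependent k (coord k : Fin r → FunField k r) := by
    have h := (MvPolynomial.algebraicIndependent_X (Fin r) k).map'
      (f := IsScalarTower.toAlgHom k (MvPolynomial (Fin r) k) (FunField k r))
      (IsFractionRing.injective _ _)
    exact h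
  set A := Algebra.adjoin k (Set.range (chartCoord k s))
  have hc : ∀ i, IsAlgebraic A (coord k i : FunField k r) := by
    intro i
    have h1 : IsAlgebraic A (chartCoord k s i) :=
      isAlgebraic_algebraMap (⟨_, Algebra.subset_adjoin ⟨i, rfl⟩⟩ : A)
    unfold chartCoord at h1
    split_ifs at h1
    · simpa using h1.inv
    · exact h1
  have hp : ∀ p : MvPolynomial (Fin r) k,
      IsAlgebraic A (algebraMap _ (FunField k r) p) := by
    intro p
    induction p using MvPolynomial.induction_on with
    | C c => exact isAlgebraic_algebraMap (algebraMap k A c)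
    | add p q hp hq => rw [map_add]; exact hp.add hq
    | mul_X p i hp => rw [map_mul]; exact hp.mul (hc i)
  have : Algebra.IsAlgebraic A (FunField k r) := by
    refine ⟨fun z => ?_⟩
    obtain ⟨p, q, -, rfl⟩ := IsFractionRing.div_surjective (A := MvPolynomial (Fin r) k) z
    rw [div_eq_mul_inv]
    exact (hp p).mul (hp q).inv
  refine (Algebra.IsAlgebraic.isTranscendenceBasis_of_lift_le_trdeg_of_finite k _ ?_).1
  exact hx.lift_cardinalMk_le_trdeg

/-- Each chart is an affine space. -/
noncomputable def chartEquiv (s : Fin r → Bool) :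
    MvPolynomial (Fin r) k ≃ₐ[k] chart k s :=
  (algebraicIndependent_chartCoord k s).aevalEquiv

/-- The prime ideal of the chart `s` corresponding to the prime `p` of the polynomial ring. -/
noncomputable def chartPrime (s : Fin r → Bool) (p : PrimeSpectrum (MvPolynomial (Fin r) k)) :
    PrimeSpectrum (chart k s).toSubring :=
  PrimeSpectrum.comap ((chartEquiv k s).symm.toRingEquiv : (chart k s) →+* _) p

/-- The rational point `(α_1, …, α_r)` of the affine chart on which all `Z_i` are nonzero. -/
noncomputable def affinePoint (α : Fin r → k) : LocalSubring (FunField k r) :=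
  LocalSubring.ofPrime (chart k fun _ => false).toSubring
    (chartPrime k (fun _ => false)
      ⟨RingHom.ker (MvPolynomial.eval α), RingHom.ker_isPrime _⟩).asIdeal

/-- The chart on which only `X_i / Z_i` is replaced by `Z_i / X_i`. -/
def invChart (i : Fin r) : Fin r → Bool := fun j => decide (j = i)

/-- The prime ideal of `E_i = V(Z_i)` in the chart `invChart i`: it is generated by `Z_i / X_i`. -/
noncomputable def polarPrime (i : Fin r) : PrimeSpectrum (chart k (invChart i)).toSubring :=
  chartPrime k (invChart i)
    ⟨Ideal.span {MvPolynomial.X i},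
      (Ideal.span_singleton_prime (MvPolynomial.X_ne_zero i)).2 MvPolynomial.X_prime⟩

theorem polar_aux (i : Fin r) :
    IsNoetherianRing (chart k (invChart i)).toSubring ∧
    ∃ y : (chart k (invChart i)).toSubring, y ≠ 0 ∧
      (polarPrime k i).asIdeal = Ideal.span {y} := by
  let e : MvPolynomial (Fin r) k ≃+* (chart k (invChart i)).toSubring :=
    (chartEquiv k (invChart i)).toRingEquiv
  refine ⟨isNoetherianRing_of_ringEquiv _ e, e (MvPolynomial.X i), ?_, ?_⟩
  · simp
  · have h1 : (polarPrime k i).asIdeal =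
        (Ideal.span {(MvPolynomial.X i : MvPolynomial (Fin r) k)}).comap e.symm := rfl
    rw [h1, Ideal.comap_symm, Ideal.map_span, Set.image_singleton]

theorem polar_isDVR (i : Fin r) :
    IsDiscreteValuationRing
      (LocalSubring.ofPrime (chart k (invChart i)).toSubring
        (polarPrime k i).asIdeal).toSubring := by
  obtain ⟨hA, y, hy, hp⟩ := polar_aux k i
  exact isDVR_ofPrime _ _ y hy hp

theorem polar_mem_or_inv_mem (i : Fin r) (z : FunField k r) :
    z ∈ (LocalSubring.ofPrime (chart k (invChart i)).toSubring (polarPrime k i).asIdeal).toSubring ∨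
    z⁻¹ ∈ (LocalSubring.ofPrime (chart k (invChart i)).toSubring
      (polarPrime k i).asIdeal).toSubring := by
  set O := (LocalSubring.ofPrime (chart k (invChart i)).toSubring
    (polarPrime k i).asIdeal).toSubring
  have hdvr : IsDiscreteValuationRing O := polar_isDVR k i
  have hO : ∀ w : FunField k r, ∃ a b : O, b ≠ 0 ∧ w = (a : FunField k r) / (b : FunField k r) := by
    have hle : ∀ u ∈ chart k (invChart i), u ∈ O := fun u hu => LocalSubring.le_ofPrime _ _ hu
    have hc : ∀ j, ∃ a b : O, b ≠ 0 ∧ coord k j = (a : FunField k r) / (b : FunField k r) := by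
      intro j
      have h1 : chartCoord k (invChart i) j ∈ O := hle _ (Algebra.subset_adjoin ⟨j, rfl⟩)
      have h0 : coord k j ≠ 0 := by
        unfold coord
        simp
      unfold chartCoord at h1
      split_ifs at h1
      · exact ⟨1, ⟨_, h1⟩, by simpa [Subtype.ext_iff] using h0, by simp⟩
      · exact ⟨⟨_, h1⟩, 1, one_ne_zero, by simp⟩
    have hp : ∀ p : MvPolynomial (Fin r) k, ∃ a b : O, b ≠ 0 ∧
        algebraMap _ (FunField k r) p = (a : FunField k r) / (b : FunField k r) := by
      intro p
      induction p using MvPolynomial.induction_on with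
      | C c => exact ⟨⟨_, hle _ (algebraMap_mem _ c)⟩, 1, one_ne_zero, by simp; rfl⟩
      | add p q hp hq =>
        obtain ⟨a, b, hb, h⟩ := hp
        obtain ⟨a', b', hb', h'⟩ := hq
        refine ⟨a * b' + b * a', b * b', mul_ne_zero hb hb', ?_⟩
        rw [map_add, h, h', div_add_div _ _ (by simpa using hb) (by simpa using hb')]
        simp
      | mul_X p j hp =>
        obtain ⟨a, b, hb, h⟩ := hp
        obtain ⟨a', b', hb', h'⟩ := hc j
        refine ⟨a * a', b * b', mul_ne_zero hb hb', ?_⟩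
        rw [map_mul, h]
        change _ * coord k j = _
        rw [h', div_mul_div_comm]
        simp
    intro w
    obtain ⟨p, q, hq, rfl⟩ := IsFractionRing.div_surjective (A := MvPolynomial (Fin r) k) w
    obtain ⟨a, b, hb, h⟩ := hp p
    obtain ⟨a', b', hb', h'⟩ := hp q
    have hq0 : algebraMap _ (FunField k r) q ≠ 0 :=
      IsFractionRing.to_map_ne_zero_of_mem_nonZeroDivisors hq
    have ha' : a' ≠ 0 := by
      rintro rfl
      exact hq0 (by rw [h']; simp)
    refine ⟨a * b', b * a', mul_ne_zero hb ha', ?_⟩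
    rw [h, h', div_div_div_eq]
    simp
  obtain ⟨a, b, hb, rfl⟩ := hO z
  have hb0 : (b : FunField k r) ≠ 0 := by simpa using hb
  rcases ValuationRing.dvd_total a b with ⟨c, rfl⟩ | ⟨c, rfl⟩
  · right
    have ha0 : (a : FunField k r) ≠ 0 := by
      rintro h
      exact hb0 (by simp [h])
    have : ((a : FunField k r) / ((a * c : O) : FunField k r))⁻¹ = c := by
      rw [inv_div, Subring.coe_mul, mul_div_cancel_left₀ _ ha0]
    rw [this]
    exact c.2
  · left
    have : ((b * c : O) : FunField k r) / (b : FunField k r) = c := by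
      rw [Subring.coe_mul, mul_div_cancel_left₀ _ hb0]
    rw [this]
    exact c.2

/-- The prime divisor `E_i = V(Z_i)` of `(ℙ¹)^r`. -/
noncomputable def polarDivisor (i : Fin r) : PrimeDivisor (P1Pow k r) where
  ring :=
    { (LocalSubring.ofPrime (chart k (invChart i)).toSubring (polarPrime k i).asIdeal).toSubring with
      mem_or_inv_mem' := polar_mem_or_inv_mem k i }
  isDVR := polar_isDVR k i
  mem := ⟨invChart i, polarPrime k i, rfl⟩

end ProductOfLines

end RectifiedCodes

/-! Both families of codes have the same simple shape: they consist of all vectors `α ↦ w α * p α`,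
with `w` a fixed nowhere zero weight on `k^r` and `p` running through the polynomials of degree at
most `n i` in the `i`-th variable (`polySpace`). The dual of `C_L(𝒫, G)` does not have this shape,
so it belongs to neither family.

The combinatorial half is `dualCode_ne_evaluation`. It rests on `∑ t ^ e = 0` over `𝔽_q` for `e < q
- 1`. If every `n i` is at least `q - 1`, the weighted code is all of `k^n`, whereas the dual is
proper because `1` lies in `C_L(𝒫, G)`. If some `n i` is smaller, take `j ≠ i`, which exists since
`r ≥ 2`. The indicator of the hyperplane `α i = 0` lies in the dual, as one sees by summing along
lines in direction `j`. Were it of the form `w * p`, then `p` would be nonzero at exactly one point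
of the `i`-th axis, so its sum along that axis would not vanish, contradicting the degree bound in
`i`.

The geometric half produces the shape. The affine chart has a unique factorization domain as
coordinate ring, so a divisor is cut out there by one function `H`. Hence `f ∈ L(W)` means `f = p /
H` with a polynomial `p`, and the remaining conditions along the `E_i` bound the degrees of `p`,
since the order along `E_i` is minus the degree in `x_i` (`mem_rrSpace_iff`, `functionalCode_eq`).
The form `dx_1 ∧ ⋯ ∧ dx_r` is regular without zeros on the chart, so the spaces of differentials
have the same description (`exists_formSpace_iff`). At a point of `𝒫` the function `h` in the
residue is `θ` times a unit times `p`, and the rectifying congruence turns the residue into a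
nonzero constant times the value of `p` (`hasResidue_iff`, `differentialCode_eq`). -/

namespace RectifiedCodes

/-! ### Local rings inside a field: vanishing, units and centers. -/

section LocalRings

variable {K : Type*} [Field K]

/-- `x` is regular at the point with local ring `P` and vanishes there. -/
def Vanishes (P : LocalSubring K) (x : K) : Prop :=
  ∃ z ∈ IsLocalRing.maximalIdeal P.toSubring, x = (z : K)

theorem Vanishes.mem {P : LocalSubring K} {x : K} (h : Vanishes P x) : x ∈ P.toSubring := by
  obtain ⟨z, -, rfl⟩ := h
  exact z.2

theorem vanishes_coe {P : LocalSubring K} {z : P.toSubring} :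
    Vanishes P (z : K) ↔ z ∈ IsLocalRing.maximalIdeal P.toSubring := by
  constructor
  · rintro ⟨w, hw, h⟩
    rwa [Subtype.ext h]
  · exact fun h => ⟨z, h, rfl⟩

theorem Vanishes.add {P : LocalSubring K} {x y : K} (hx : Vanishes P x) (hy : Vanishes P y) :
    Vanishes P (x + y) := by
  obtain ⟨z, hz, rfl⟩ := hx
  obtain ⟨w, hw, rfl⟩ := hy
  exact ⟨z + w, add_mem hz hw, rfl⟩

theorem Vanishes.neg {P : LocalSubring K} {x : K} (hx : Vanishes P x) : Vanishes P (-x) := by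
  obtain ⟨z, hz, rfl⟩ := hx
  exact ⟨-z, neg_mem hz, rfl⟩

theorem Vanishes.sub {P : LocalSubring K} {x y : K} (hx : Vanishes P x) (hy : Vanishes P y) :
    Vanishes P (x - y) := sub_eq_add_neg x y ▸ hx.add hy.neg

theorem Vanishes.mul_left {P : LocalSubring K} {x y : K} (hx : x ∈ P.toSubring)
    (hy : Vanishes P y) : Vanishes P (x * y) := by
  obtain ⟨z, hz, rfl⟩ := hy
  exact ⟨⟨x, hx⟩ * z, Ideal.mul_mem_left _ _ hz, rfl⟩

theorem Vanishes.mul_right {P : LocalSubring K} {x y : K} (hx : Vanishes P x)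
    (hy : y ∈ P.toSubring) : Vanishes P (x * y) := mul_comm x y ▸ hx.mul_left hy

theorem vanishes_zero (P : LocalSubring K) : Vanishes P 0 := ⟨0, zero_mem _, rfl⟩

theorem not_vanishes_one (P : LocalSubring K) : ¬ Vanishes P 1 := by
  rintro ⟨z, hz, h⟩
  have : z = 1 := Subtype.ext h.symm
  exact (Ideal.ne_top_iff_one _).1 (IsLocalRing.maximalIdeal.isMaximal _).ne_top (this ▸ hz)

theorem not_vanishes_of_inv_mem {P : LocalSubring K} {x : K} (hx : x ≠ 0)
    (h : x⁻¹ ∈ P.toSubring) : ¬ Vanishes P x := fun hv =>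
  not_vanishes_one P (by simpa [hx] using hv.mul_left h)

theorem ne_zero_of_not_vanishes {P : LocalSubring K} {x : K} (h : ¬ Vanishes P x) : x ≠ 0 := by
  rintro rfl
  exact h (vanishes_zero P)

theorem inv_mem_of_not_vanishes {P : LocalSubring K} {x : K} (hx : x ∈ P.toSubring)
    (h : ¬ Vanishes P x) : x⁻¹ ∈ P.toSubring := by
  have hu : IsUnit (⟨x, hx⟩ : P.toSubring) := by
    by_contra hu
    exact h ⟨⟨x, hx⟩, (IsLocalRing.mem_maximalIdeal _).2 hu, rfl⟩
  obtain ⟨y, hy⟩ := hu.exists_right_inv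
  have h1 : x * (y : K) = 1 := congrArg Subtype.val hy
  rw [← eq_inv_of_mul_eq_one_right h1]
  exact y.2

theorem vanishes_mul_iff {P : LocalSubring K} {x y : K} (hx : x ∈ P.toSubring)
    (hy : y ∈ P.toSubring) : Vanishes P (x * y) ↔ Vanishes P x ∨ Vanishes P y := by
  refine ⟨fun h => ?_, fun h => h.elim (fun h => h.mul_right hy) (fun h => h.mul_left hx)⟩
  by_contra! hc
  have h0 := ne_zero_of_not_vanishes hc.1
  apply hc.2
  simpa [h0] using h.mul_left (inv_mem_of_not_vanishes hx hc.1)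

theorem vanishes_inv_of_not_mem (P : ValuationSubring K) {x : K} (hx : x ∉ P) :
    Vanishes P.toLocalSubring x⁻¹ := by
  have h := (P.mem_or_inv_mem x).resolve_left hx
  by_contra hc
  have h1 := inv_mem_of_not_vanishes (P := P.toLocalSubring) h hc
  rw [inv_inv] at h1
  exact hx h1

theorem mem_ofPrime_iff (A : Subring K) (p : Ideal A) [p.IsPrime] (x : K) :
    x ∈ (LocalSubring.ofPrime A p).toSubring ↔ ∃ a b : A, b ∉ p ∧ x = (a : K) / (b : K) := by
  constructor
  · intro hx
    obtain ⟨⟨a, b⟩, h⟩ := IsLocalization.surj p.primeCompl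
      (⟨x, hx⟩ : (LocalSubring.ofPrime A p).toSubring)
    have hb : ((b : A) : K) ≠ 0 := fun h0 => b.2 (by
      have : (b : A) = 0 := Subtype.ext h0
      rw [this]; exact zero_mem _)
    refine ⟨a, b, b.2, ?_⟩
    rw [eq_div_iff hb]
    exact congrArg Subtype.val h
  · rintro ⟨a, b, hb, rfl⟩
    have hu := IsLocalization.map_units (LocalSubring.ofPrime A p).toSubring
      (⟨b, hb⟩ : p.primeCompl)
    obtain ⟨c, hc⟩ := hu.exists_right_inv
    have h1 : (b : K) * (c : K) = 1 := congrArg Subtype.val hc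
    rw [div_eq_mul_inv, ← eq_inv_of_mul_eq_one_right h1]
    exact mul_mem (LocalSubring.le_ofPrime A p a.2) c.2

theorem vanishes_ofPrime_iff (A : Subring K) (p : Ideal A) [p.IsPrime] (a : A) :
    Vanishes (LocalSubring.ofPrime A p) (a : K) ↔ a ∈ p := by
  have h := IsLocalization.AtPrime.to_map_mem_maximal_iff
    (LocalSubring.ofPrime A p).toSubring p a
  rw [← h, ← vanishes_coe]
  rfl

/-- The center on `B` of a local ring containing `B`. -/
def centerIdeal (B : Subring K) (P : LocalSubring K) (h : B ≤ P.toSubring) : Ideal B :=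
  (IsLocalRing.maximalIdeal P.toSubring).comap (Subring.inclusion h)

instance (B : Subring K) (P : LocalSubring K) (h : B ≤ P.toSubring) :
    (centerIdeal B P h).IsPrime := Ideal.comap_isPrime _ _

theorem mem_centerIdeal {B : Subring K} {P : LocalSubring K} {h : B ≤ P.toSubring} {b : B} :
    b ∈ centerIdeal B P h ↔ Vanishes P (b : K) :=
  (vanishes_coe (z := Subring.inclusion h b)).symm

/-- This is the change of charts. An element of `A` outside `p` is `c / d` over `B`, and `c` cannot
vanish at the point because the element would then vanish too; so its inverse already lies in the
localization of `B`. -/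
theorem ofPrime_eq_ofPrime_center (A B : Subring K) (p : Ideal A) [p.IsPrime]
    (h : B ≤ (LocalSubring.ofPrime A p).toSubring)
    (hA : A ≤ (LocalSubring.ofPrime B (centerIdeal B (LocalSubring.ofPrime A p) h)).toSubring) :
    LocalSubring.ofPrime A p =
      LocalSubring.ofPrime B (centerIdeal B (LocalSubring.ofPrime A p) h) := by
  apply LocalSubring.toSubring_injective
  apply le_antisymm
  · intro x hx
    obtain ⟨a, b, hb, rfl⟩ := (mem_ofPrime_iff _ _ _).1 hx
    rw [div_eq_mul_inv]
    refine mul_mem (hA a.2) ?_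
    obtain ⟨c, d, hd, hcd⟩ := (mem_ofPrime_iff _ _ _).1 (hA b.2)
    rw [mem_centerIdeal] at hd
    have hc : c ∉ centerIdeal B (LocalSubring.ofPrime A p) h := by
      rw [mem_centerIdeal]
      intro hc
      apply hb
      rw [← vanishes_ofPrime_iff, hcd, div_eq_mul_inv]
      exact hc.mul_right (inv_mem_of_not_vanishes (h d.2) hd)
    rw [mem_ofPrime_iff]
    exact ⟨d, c, hc, by rw [hcd, inv_div]⟩
  · intro x hx
    obtain ⟨a, b, hb, rfl⟩ := (mem_ofPrime_iff _ _ _).1 hx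
    rw [mem_centerIdeal] at hb
    rw [div_eq_mul_inv]
    exact mul_mem (h a.2) (inv_mem_of_not_vanishes (h b.2) hb)

end LocalRings

/-! ### Orders of vanishing along a prime divisor. -/

section Orders

variable {K : Type*} [Field K] {X : Set (LocalSubring K)} (Y : PrimeDivisor X)

theorem PrimeDivisor.ext_ring {Y Z : PrimeDivisor X} (h : Y.ring = Z.ring) : Y = Z := by
  cases Y; cases Z; cases h; rfl

theorem PrimeDivisor.ordFrac_ne_zero {f : K} (hf : f ≠ 0) : Ring.ordFrac Y.ring f ≠ 0 :=
  (map_ne_zero _).2 hf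

theorem PrimeDivisor.ord_mul {f g : K} (hf : f ≠ 0) (hg : g ≠ 0) :
    Y.ord (f * g) = Y.ord f + Y.ord g := by
  unfold PrimeDivisor.ord
  rw [map_mul, WithZero.log_mul (Y.ordFrac_ne_zero hf) (Y.ordFrac_ne_zero hg)]

@[simp]
theorem PrimeDivisor.ord_zero : Y.ord 0 = 0 := by
  simp [PrimeDivisor.ord]

@[simp]
theorem PrimeDivisor.ord_one : Y.ord 1 = 0 := by
  simp [PrimeDivisor.ord]

@[simp]
theorem PrimeDivisor.ord_inv (f : K) : Y.ord f⁻¹ = - Y.ord f := by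
  simp [PrimeDivisor.ord]

theorem PrimeDivisor.ord_div {f g : K} (hf : f ≠ 0) (hg : g ≠ 0) :
    Y.ord (f / g) = Y.ord f - Y.ord g := by
  rw [div_eq_mul_inv, Y.ord_mul hf (inv_ne_zero hg), Y.ord_inv, sub_eq_add_neg]

@[simp]
theorem PrimeDivisor.ord_zpow (f : K) (n : ℤ) : Y.ord (f ^ n) = n * Y.ord f := by
  simp [PrimeDivisor.ord]

@[simp]
theorem PrimeDivisor.ord_pow (f : K) (n : ℕ) : Y.ord (f ^ n) = n * Y.ord f := by
  simp [PrimeDivisor.ord]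

theorem PrimeDivisor.ord_prod {ι : Type*} (s : Finset ι) (f : ι → K) (hf : ∀ i ∈ s, f i ≠ 0) :
    Y.ord (∏ i ∈ s, f i) = ∑ i ∈ s, Y.ord (f i) := by
  classical
  induction s using Finset.induction_on with
  | empty => simp
  | insert a s ha ih =>
    rw [Finset.prod_insert ha, Finset.sum_insert ha, Y.ord_mul (hf _ (by simp)),
      ih fun i hi => hf i (by simp [hi])]
    exact Finset.prod_ne_zero_iff.2 fun i hi => hf i (by simp [hi])

theorem PrimeDivisor.ord_nonneg_of_mem {f : K} (hf : f ∈ Y.ring) : 0 ≤ Y.ord f := by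
  by_cases h0 : f = 0
  · simp [h0]
  have h1 : (⟨f, hf⟩ : Y.ring) ≠ 0 := fun h => h0 (congrArg Subtype.val h)
  have h2 := Ring.ordFrac_ge_one_of_ne_zero (R := Y.ring) (K := K) h1
  have h3 : (1 : WithZero (Multiplicative ℤ)) ≤ Ring.ordFrac Y.ring f := h2
  have := (WithZero.log_le_log one_ne_zero (Y.ordFrac_ne_zero h0)).2 h3
  simpa [PrimeDivisor.ord] using this

theorem PrimeDivisor.ord_eq_zero_of_mem {f : K} (hf : f ∈ Y.ring) (hf' : f⁻¹ ∈ Y.ring) :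
    Y.ord f = 0 := by
  have h1 := Y.ord_nonneg_of_mem hf
  have h2 := Y.ord_nonneg_of_mem hf'
  rw [Y.ord_inv] at h2
  omega

theorem PrimeDivisor.ord_uniformizer {z : K} (hz : z ∈ Y.ring)
    (h : IsLocalRing.maximalIdeal Y.ring = Ideal.span {⟨z, hz⟩}) : Y.ord z = 1 := by
  have h1 : Irreducible (⟨z, hz⟩ : Y.ring) :=
    (IsDiscreteValuationRing.irreducible_iff_uniformizer _).2 h
  have h3 : Ring.ordFrac Y.ring z = WithZero.exp 1 :=
    Ring.ordFrac_irreducible (R := Y.ring) (K := K) h1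
  simp [PrimeDivisor.ord, h3]

theorem PrimeDivisor.ord_pos_of_vanishes {f : K} (hf : f ≠ 0)
    (h : Vanishes Y.ring.toLocalSubring f) : 0 < Y.ord f := by
  obtain ⟨ϖ, hϖ⟩ := IsDiscreteValuationRing.exists_irreducible Y.ring
  have hm := (IsDiscreteValuationRing.irreducible_iff_uniformizer _).1 hϖ
  have h1 := Y.ord_uniformizer ϖ.2 hm
  obtain ⟨z, hz, rfl⟩ := h
  obtain ⟨w, hw, hwz⟩ : ∃ w : Y.ring, w ∈ IsLocalRing.maximalIdeal Y.ring ∧ (w : K) = (z : K) :=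
    ⟨z, hz, rfl⟩
  rw [hm, Ideal.mem_span_singleton] at hw
  obtain ⟨c, rfl⟩ := hw
  have hc := Y.ord_nonneg_of_mem c.2
  have e : ((ϖ * c : Y.ring) : K) = (ϖ : K) * (c : K) := rfl
  rw [← hwz, e] at hf ⊢
  rw [Y.ord_mul (left_ne_zero_of_mul hf) (right_ne_zero_of_mul hf)]
  omega

theorem PrimeDivisor.mem_ring_iff {f : K} (hf : f ≠ 0) : f ∈ Y.ring ↔ 0 ≤ Y.ord f := by
  refine ⟨Y.ord_nonneg_of_mem, fun h => ?_⟩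
  by_contra hc
  have := Y.ord_pos_of_vanishes (inv_ne_zero hf) (vanishes_inv_of_not_mem _ hc)
  rw [Y.ord_inv] at this
  omega

theorem PrimeDivisor.exists_ord_eq (n : ℤ) : ∃ g : K, g ≠ 0 ∧ Y.ord g = n := by
  obtain ⟨ϖ, hϖ⟩ := IsDiscreteValuationRing.exists_irreducible Y.ring
  have hm := (IsDiscreteValuationRing.irreducible_iff_uniformizer _).1 hϖ
  have h1 := Y.ord_uniformizer ϖ.2 hm
  have h0 : (ϖ : K) ≠ 0 := fun h => hϖ.ne_zero (Subtype.ext h)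
  exact ⟨(ϖ : K) ^ n, zpow_ne_zero _ h0, by rw [Y.ord_zpow]; simp [h1]⟩

end Orders

/-- Apply the hypothesis to a uniformizer `ϖ`: the order `1 - ord z` of `ϖ / z` is nonnegative,
while `ord z` is positive. -/
theorem PrimeDivisor.ord_eq_one {K : Type*} [Field K] {X : Set (LocalSubring K)}
    (Y : PrimeDivisor X) {z : K} (hz0 : z ≠ 0) (hz : Vanishes Y.ring.toLocalSubring z)
    (h : ∀ f : K, Vanishes Y.ring.toLocalSubring f → f / z ∈ Y.ring) : Y.ord z = 1 := by
  obtain ⟨ϖ, hϖ⟩ := IsDiscreteValuationRing.exists_irreducible Y.ring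
  have hm := (IsDiscreteValuationRing.irreducible_iff_uniformizer _).1 hϖ
  have h1 := Y.ord_uniformizer ϖ.2 hm
  have h0 : (ϖ : K) ≠ 0 := fun h => hϖ.ne_zero (Subtype.ext h)
  have h2 := Y.ord_nonneg_of_mem
    (h ϖ ⟨ϖ, (IsLocalRing.mem_maximalIdeal _).2 hϖ.not_isUnit, rfl⟩)
  rw [Y.ord_div h0 hz0] at h2
  have := Y.ord_pos_of_vanishes hz0 hz
  omega

/-! ### Points of `(ℙ¹)^r` in the standard charts. -/

section Charts

variable (k : Type*) [Field k] {r : ℕ}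

theorem coord_ne_zero (i : Fin r) : coord k i ≠ 0 := by
  unfold coord
  simp

theorem chartCoord_ne_zero (s : Fin r → Bool) (i : Fin r) : chartCoord k s i ≠ 0 := by
  unfold chartCoord
  split_ifs
  · exact inv_ne_zero (coord_ne_zero k i)
  · exact coord_ne_zero k i

/-- The embedding of the coordinate ring of the chart `s` into the function field. -/
noncomputable def chartMap (s : Fin r → Bool) : MvPolynomial (Fin r) k →ₐ[k] FunField k r :=
  MvPolynomial.aeval (chartCoord k s)

@[simp]
theorem chartMap_X (s : Fin r → Bool) (i : Fin r) :
    chartMap k s (MvPolynomial.X i) = chartCoord k s i := by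
  simp [chartMap]

theorem chartMap_injective (s : Fin r → Bool) : Function.Injective (chartMap k s) :=
  algebraicIndependent_chartCoord k s

theorem chartMap_ne_zero (s : Fin r → Bool) {p : MvPolynomial (Fin r) k} (hp : p ≠ 0) :
    chartMap k s p ≠ 0 := by
  rwa [Ne, map_eq_zero_iff _ (chartMap_injective k s)]

theorem chartMap_affine (p : MvPolynomial (Fin r) k) :
    chartMap k (fun _ => false) p = algebraMap _ (FunField k r) p := by
  have : chartMap k (fun _ => false) =
      IsScalarTower.toAlgHom k (MvPolynomial (Fin r) k) (FunField k r) := by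
    ext i
    simp [chartCoord, coord]
  rw [this]
  rfl

theorem coe_chartEquiv (s : Fin r → Bool) (p : MvPolynomial (Fin r) k) :
    ((chartEquiv k s p : chart k s) : FunField k r) = chartMap k s p :=
  (algebraicIndependent_chartCoord k s).algebraMap_aevalEquiv p

/-- The point of the chart `s` with prime ideal `q`. -/
noncomputable def chartPoint (s : Fin r → Bool) (q : PrimeSpectrum (MvPolynomial (Fin r) k)) :
    LocalSubring (FunField k r) :=
  LocalSubring.ofPrime (chart k s).toSubring (chartPrime k s q).asIdeal

theorem mem_chartPrime (s : Fin r → Bool) (q : PrimeSpectrum (MvPolynomial (Fin r) k))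
    (p : MvPolynomial (Fin r) k) :
    (chartEquiv k s p : (chart k s).toSubring) ∈ (chartPrime k s q).asIdeal ↔ p ∈ q.asIdeal := by
  change (chartEquiv k s).symm (chartEquiv k s p) ∈ q.asIdeal ↔ _
  rw [AlgEquiv.symm_apply_apply]

variable {k}

theorem mem_chartPoint {s : Fin r → Bool} {q : PrimeSpectrum (MvPolynomial (Fin r) k)}
    {x : FunField k r} : x ∈ (chartPoint k s q).toSubring ↔
      ∃ a b : MvPolynomial (Fin r) k, b ∉ q.asIdeal ∧ x = chartMap k s a / chartMap k s b := by
  unfold chartPoint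
  rw [mem_ofPrime_iff]
  constructor
  · rintro ⟨a, b, hb, rfl⟩
    obtain ⟨a', rfl⟩ := (chartEquiv k s).surjective a
    obtain ⟨b', rfl⟩ := (chartEquiv k s).surjective b
    exact ⟨a', b', fun h => hb ((mem_chartPrime k s q b').2 h), by
      rw [← coe_chartEquiv, ← coe_chartEquiv]⟩
  · rintro ⟨a, b, hb, rfl⟩
    exact ⟨chartEquiv k s a, chartEquiv k s b, fun h => hb ((mem_chartPrime k s q b).1 h), by
      rw [← coe_chartEquiv, ← coe_chartEquiv]⟩

theorem chartMap_mem_chartPoint (s : Fin r → Bool) (q : PrimeSpectrum (MvPolynomial (Fin r) k))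
    (p : MvPolynomial (Fin r) k) : chartMap k s p ∈ (chartPoint k s q).toSubring :=
  mem_chartPoint.2 ⟨p, 1, fun h => q.2.ne_top ((Ideal.eq_top_iff_one _).2 h), by simp⟩

theorem vanishes_chartPoint {s : Fin r → Bool} {q : PrimeSpectrum (MvPolynomial (Fin r) k)}
    {p : MvPolynomial (Fin r) k} : Vanishes (chartPoint k s q) (chartMap k s p) ↔ p ∈ q.asIdeal := by
  rw [← mem_chartPrime k s q p, ← vanishes_ofPrime_iff, ← coe_chartEquiv]
  rfl

theorem exists_chartPrime (s : Fin r → Bool) (p : PrimeSpectrum (chart k s).toSubring) :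
    ∃ q, p = chartPrime k s q := by
  refine ⟨PrimeSpectrum.comap
    ((chartEquiv k s).toRingEquiv : _ →+* (chart k s).toSubring) p, ?_⟩
  ext y
  change y ∈ p.asIdeal ↔ chartEquiv k s ((chartEquiv k s).symm y) ∈ p.asIdeal
  rw [AlgEquiv.apply_symm_apply]

theorem exists_chartPoint {P : LocalSubring (FunField k r)} (hP : P ∈ P1Pow k r) :
    ∃ s q, P = chartPoint k s q := by
  obtain ⟨s, p, rfl⟩ := hP
  obtain ⟨q, rfl⟩ := exists_chartPrime s p
  exact ⟨s, q, rfl⟩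

theorem chartPoint_mem (s : Fin r → Bool) (q : PrimeSpectrum (MvPolynomial (Fin r) k)) :
    chartPoint k s q ∈ P1Pow k r := ⟨s, chartPrime k s q, rfl⟩

theorem chart_le_of_coord_mem {s : Fin r → Bool} {B : Subring (FunField k r)}
    (hk : ∀ c : k, algebraMap k _ c ∈ B) (h : ∀ i, chartCoord k s i ∈ B) :
    (chart k s).toSubring ≤ B := by
  intro x hx
  replace hx : x ∈ Algebra.adjoin k (Set.range (chartCoord k s)) := hx
  induction hx using Algebra.adjoin_induction with
  | mem x hx =>
    obtain ⟨i, rfl⟩ := hx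
    exact h i
  | algebraMap c => exact hk c
  | add x y hx hy h1 h2 => exact add_mem h1 h2
  | mul x y hx hy h1 h2 => exact mul_mem h1 h2

theorem algebraMap_mem_of_mem {P : LocalSubring (FunField k r)} (hP : P ∈ P1Pow k r) (c : k) :
    algebraMap k _ c ∈ P.toSubring := by
  obtain ⟨s, q, rfl⟩ := exists_chartPoint hP
  simpa using chartMap_mem_chartPoint s q (MvPolynomial.C c)

/-- A point belongs to every chart whose coordinates are regular there. Two charts differ by
inverting some coordinates, and a coordinate that is regular together with its inverse is a unit at
the point, so the inversion can be carried out in the localization of the other chart. -/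
theorem exists_chartPoint_of_coord_mem {P : LocalSubring (FunField k r)} (hP : P ∈ P1Pow k r)
    (s : Fin r → Bool) (h : ∀ i, chartCoord k s i ∈ P.toSubring) :
    ∃ q, P = chartPoint k s q := by
  have hk := algebraMap_mem_of_mem hP
  have hle := chart_le_of_coord_mem hk h
  obtain ⟨t, p, rfl⟩ := hP
  have key := ofPrime_eq_ofPrime_center _ (chart k s).toSubring p.asIdeal hle ?_
  · obtain ⟨q, hq⟩ := exists_chartPrime s ⟨centerIdeal _ _ hle, inferInstance⟩
    refine ⟨q, key.trans ?_⟩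
    unfold chartPoint
    congr 1
    exact congrArg PrimeSpectrum.asIdeal hq
  · refine chart_le_of_coord_mem (fun c => ?_) fun i => ?_
    · exact LocalSubring.le_ofPrime _ _ ((chart k s).algebraMap_mem c)
    · have hs : chartCoord k s i ∈ (chart k s).toSubring := Algebra.subset_adjoin ⟨i, rfl⟩
      by_cases hst : chartCoord k t i = chartCoord k s i
      · rw [hst]
        exact LocalSubring.le_ofPrime _ _ hs
      · have hinv : chartCoord k t i = (chartCoord k s i)⁻¹ := by
          unfold chartCoord at hst ⊢
          split_ifs at hst ⊢ <;> simp_all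
        have ht : chartCoord k t i ∈ (LocalSubring.ofPrime (chart k t).toSubring
            p.asIdeal).toSubring :=
          LocalSubring.le_ofPrime _ _ (Algebra.subset_adjoin ⟨i, rfl⟩)
        rw [mem_ofPrime_iff]
        refine ⟨1, ⟨_, hs⟩, ?_, by rw [hinv]; simp⟩
        rw [mem_centerIdeal]
        exact not_vanishes_of_inv_mem (chartCoord_ne_zero k s i) (hinv ▸ ht)

end Charts

/-! ### Prime divisors: the `E_i` and the closures of affine hypersurfaces. -/

section PrimeDivisors

variable {k : Type*} [Field k] {r : ℕ}

/-- The point of the prime spectrum generated by a prime element. -/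
noncomputable def spanPrime {z : MvPolynomial (Fin r) k} (hz : Prime z) :
    PrimeSpectrum (MvPolynomial (Fin r) k) :=
  ⟨Ideal.span {z}, (Ideal.span_singleton_prime hz.ne_zero).2 hz⟩

theorem mem_spanPrime {z : MvPolynomial (Fin r) k} (hz : Prime z) {a : MvPolynomial (Fin r) k} :
    a ∈ (spanPrime hz).asIdeal ↔ z ∣ a := Ideal.mem_span_singleton

/-- A divisor on which the prime `z` vanishes is the generic point of `z = 0`. In the discrete
valuation ring `z` divides a power of any other `a` in the prime ideal; clearing a denominator `d`
outside the ideal gives `z ∣ a ^ N * d`, hence `z ∣ a`. -/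
theorem PrimeDivisor.eq_chartPoint (Y : PrimeDivisor (P1Pow k r)) {s : Fin r → Bool}
    (h : ∀ i, chartCoord k s i ∈ Y.ring) {z : MvPolynomial (Fin r) k} (hz : Prime z)
    (hv : Vanishes Y.ring.toLocalSubring (chartMap k s z)) :
    Y.ring.toLocalSubring = chartPoint k s (spanPrime hz) := by
  obtain ⟨q, hq⟩ := exists_chartPoint_of_coord_mem Y.mem s h
  rw [hq]
  congr 1
  have hz0 := chartMap_ne_zero k s hz.ne_zero
  ext a
  rw [mem_spanPrime]
  constructor
  · intro ha
    by_cases ha0 : a = 0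
    · simp [ha0]
    have ha0' := chartMap_ne_zero k s ha0
    have hva : Vanishes Y.ring.toLocalSubring (chartMap k s a) := by
      rw [hq]
      exact vanishes_chartPoint.2 ha
    have hpos := Y.ord_pos_of_vanishes ha0' hva
    -- The exponent `ord z` suffices because `ord a ≥ 1`.
    have hmem : chartMap k s a ^ (Y.ord (chartMap k s z)).toNat / chartMap k s z ∈ Y.ring := by
      rw [Y.mem_ring_iff (div_ne_zero (pow_ne_zero _ ha0') hz0), Y.ord_div (pow_ne_zero _ ha0') hz0,
        Y.ord_pow]
      have h1 := Y.ord_pos_of_vanishes hz0 hv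
      rw [Int.toNat_of_nonneg h1.le]
      nlinarith
    have hmem' : _ ∈ Y.ring.toLocalSubring.toSubring := hmem
    rw [hq] at hmem'
    obtain ⟨c, d, hd, e⟩ := mem_chartPoint.1 hmem'
    have hd0 : d ≠ 0 := by
      rintro rfl
      exact hd (zero_mem _)
    rw [div_eq_div_iff hz0 (chartMap_ne_zero k s hd0), ← map_pow, ← map_mul, ← map_mul] at e
    have e' := chartMap_injective k s e
    have hdvd : z ∣ a ^ (Y.ord (chartMap k s z)).toNat * d := ⟨c, by rw [e', mul_comm]⟩
    rcases hz.dvd_or_dvd hdvd with h1 | h1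
    · exact hz.dvd_of_dvd_pow h1
    · exfalso
      apply hd
      rw [hq] at hv
      exact Ideal.mem_of_dvd _ h1 (vanishes_chartPoint.1 hv)
  · intro ha
    rw [hq] at hv
    exact Ideal.mem_of_dvd _ ha (vanishes_chartPoint.1 hv)

theorem PrimeDivisor.ord_chartMap_prime (Y : PrimeDivisor (P1Pow k r)) {s : Fin r → Bool}
    {z : MvPolynomial (Fin r) k} (hz : Prime z)
    (hY : Y.ring.toLocalSubring = chartPoint k s (spanPrime hz)) :
    Y.ord (chartMap k s z) = 1 := by
  have hz0 := chartMap_ne_zero k s hz.ne_zero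
  refine Y.ord_eq_one hz0 (hY ▸ vanishes_chartPoint.2 ((mem_spanPrime hz).2 dvd_rfl)) ?_
  intro f hf
  have hf' : f ∈ Y.ring.toLocalSubring.toSubring := hf.mem
  rw [hY] at hf' hf
  obtain ⟨a, b, hb, rfl⟩ := mem_chartPoint.1 hf'
  have hb0 : chartMap k s b ≠ 0 := chartMap_ne_zero k s (by rintro rfl; exact hb (zero_mem _))
  have ha := hf.mul_right (chartMap_mem_chartPoint s (spanPrime hz) b)
  rw [div_mul_cancel₀ _ hb0, vanishes_chartPoint, mem_spanPrime] at ha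
  obtain ⟨c, rfl⟩ := ha
  change _ ∈ Y.ring.toLocalSubring.toSubring
  rw [hY]
  refine mem_chartPoint.2 ⟨c, b, hb, ?_⟩
  rw [map_mul]
  field_simp

/-- The prime divisor meets the affine chart on which all `Z_i` are nonzero. -/
def PrimeDivisor.IsAffine (Y : PrimeDivisor (P1Pow k r)) : Prop := ∀ i, coord k i ∈ Y.ring

theorem not_X_dvd_X {i j : Fin r} (h : j ≠ i) :
    ¬ (MvPolynomial.X i : MvPolynomial (Fin r) k) ∣ MvPolynomial.X j := by
  rw [MvPolynomial.X_dvd_X]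
  simpa using h.symm

theorem polarDivisor_toLocalSubring (i : Fin r) :
    (polarDivisor k i).ring.toLocalSubring =
      chartPoint k (invChart i) (spanPrime (MvPolynomial.X_prime (i := i))) := rfl

theorem chartCoord_invChart_self (i : Fin r) : chartCoord k (invChart i) i = (coord k i)⁻¹ := by
  simp [chartCoord, invChart]

theorem chartCoord_invChart_of_ne {i j : Fin r} (h : j ≠ i) :
    chartCoord k (invChart i) j = coord k j := by
  simp [chartCoord, invChart, h]

/-- If `x_i` has a pole along `Y`, any chart containing `Y` uses `1 / x_i`, which vanishes on `Y`;
so `Y` is the generic point of that coordinate hyperplane. The other coordinates are not divisible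
by it, hence are units along `Y`, and inverting them leads to the chart `invChart i`. -/
theorem PrimeDivisor.eq_polarDivisor (Y : PrimeDivisor (P1Pow k r)) {i : Fin r}
    (hi : coord k i ∉ Y.ring) : Y = polarDivisor k i := by
  obtain ⟨s, q, hq⟩ := exists_chartPoint Y.mem
  have hs : ∀ j, chartCoord k s j ∈ Y.ring := by
    intro j
    change _ ∈ Y.ring.toLocalSubring.toSubring
    rw [hq]
    simpa using chartMap_mem_chartPoint s q (MvPolynomial.X j)
  have hsi : chartCoord k s i = (coord k i)⁻¹ := by
    have := hs i
    unfold chartCoord at this ⊢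
    split_ifs at this ⊢
    · rfl
    · exact absurd this hi
  have hv := vanishes_inv_of_not_mem _ hi
  have h1 := Y.eq_chartPoint hs (z := MvPolynomial.X i) MvPolynomial.X_prime
    (by rwa [chartMap_X, hsi])
  have h2 := Y.eq_chartPoint (s := invChart i) (z := MvPolynomial.X i) (fun j => ?_)
    MvPolynomial.X_prime (by rwa [chartMap_X, chartCoord_invChart_self])
  · apply PrimeDivisor.ext_ring
    apply ValuationSubring.toSubring_injective
    exact congrArg LocalSubring.toSubring h2
  · by_cases hj : j = i
    · rw [hj, chartCoord_invChart_self, ← hsi]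
      exact hs i
    · rw [chartCoord_invChart_of_ne hj]
      have hm := hs j
      have hn : ¬ Vanishes Y.ring.toLocalSubring (chartCoord k s j) := by
        rw [h1, ← chartMap_X, vanishes_chartPoint, mem_spanPrime]
        exact not_X_dvd_X hj
      have hinv : (chartCoord k s j)⁻¹ ∈ Y.ring :=
        inv_mem_of_not_vanishes (P := Y.ring.toLocalSubring) hm hn
      unfold chartCoord at hm hinv
      split_ifs at hm hinv
      · simpa using hinv
      · exact hm

theorem not_isAffine_polarDivisor (i : Fin r) : coord k i ∉ (polarDivisor k i).ring := by
  intro h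
  have hv : Vanishes (polarDivisor k i).ring.toLocalSubring (coord k i)⁻¹ := by
    rw [polarDivisor_toLocalSubring, ← chartCoord_invChart_self, ← chartMap_X, vanishes_chartPoint,
      mem_spanPrime]
  exact not_vanishes_of_inv_mem (P := (polarDivisor k i).ring.toLocalSubring)
    (inv_ne_zero (coord_ne_zero k i)) (by rwa [inv_inv]) hv

theorem coord_mem_polarDivisor {i j : Fin r} (h : j ≠ i) : coord k j ∈ (polarDivisor k i).ring := by
  rw [← chartCoord_invChart_of_ne h, ← chartMap_X]
  exact chartMap_mem_chartPoint (invChart i) (spanPrime MvPolynomial.X_prime) _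

theorem polarDivisor_injective : Function.Injective (polarDivisor k : Fin r → _) := by
  intro i j h
  by_contra hij
  exact not_isAffine_polarDivisor (k := k) i (h ▸ coord_mem_polarDivisor hij)

theorem PrimeDivisor.isAffine_or_eq_polarDivisor (Y : PrimeDivisor (P1Pow k r)) :
    Y.IsAffine ∨ ∃ i, Y = polarDivisor k i := by
  by_cases h : Y.IsAffine
  · exact Or.inl h
  · unfold PrimeDivisor.IsAffine at h
    push Not at h
    obtain ⟨i, hi⟩ := h
    exact Or.inr ⟨i, Y.eq_polarDivisor hi⟩

theorem ord_polarDivisor_inv_coord (i : Fin r) : (polarDivisor k i).ord (coord k i)⁻¹ = 1 := by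
  rw [← chartCoord_invChart_self, ← chartMap_X]
  exact PrimeDivisor.ord_chartMap_prime _ MvPolynomial.X_prime (polarDivisor_toLocalSubring i)

/-- The embedding of the coordinate ring of the affine chart on which all `Z_i` are nonzero. -/
noncomputable abbrev affineMap : MvPolynomial (Fin r) k →+* FunField k r :=
  algebraMap (MvPolynomial (Fin r) k) (FunField k r)

theorem affineMap_ne_zero {p : MvPolynomial (Fin r) k} (hp : p ≠ 0) : affineMap p ≠ 0 := by
  rw [← chartMap_affine]
  exact chartMap_ne_zero k _ hp

theorem exists_reduced (f : FunField k r) : ∃ a b : MvPolynomial (Fin r) k, b ≠ 0 ∧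
    IsRelPrime a b ∧ f = affineMap a / affineMap b := by
  obtain ⟨a, b, hab, rfl⟩ := IsFractionRing.exists_reduced_fraction
    (A := MvPolynomial (Fin r) k) f
  exact ⟨a, b, nonZeroDivisors.coe_ne_zero b, hab, by rw [IsFractionRing.mk'_eq_div]⟩

theorem div_mem_chartPoint {q : PrimeSpectrum (MvPolynomial (Fin r) k)}
    {a b : MvPolynomial (Fin r) k} (hb : b ∉ q.asIdeal) :
    affineMap a / affineMap b ∈ (chartPoint k (fun _ => false) q).toSubring :=
  mem_chartPoint.2 ⟨a, b, hb, by rw [chartMap_affine, chartMap_affine]⟩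

/-- The closure in `(ℙ¹)^r` of the hypersurface defined by a prime polynomial. -/
noncomputable def hypersurface {z : MvPolynomial (Fin r) k} (hz : Prime z) :
    PrimeDivisor (P1Pow k r) where
  ring :=
    { (chartPoint k (fun _ => false) (spanPrime hz)).toSubring with
      mem_or_inv_mem' := by
        intro f
        obtain ⟨a, b, hb, hab, rfl⟩ := exists_reduced f
        by_cases h : z ∣ b
        · right
          rw [inv_div]
          refine div_mem_chartPoint fun ha => hz.not_isUnit (hab ?_ h)
          exact (mem_spanPrime hz).1 ha
        · left
          exact div_mem_chartPoint fun hb => h ((mem_spanPrime hz).1 hb) }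
  isDVR := by
    let e : MvPolynomial (Fin r) k ≃+* (chart k fun _ => false).toSubring :=
      (chartEquiv k _).toRingEquiv
    have hN : IsNoetherianRing (chart k fun _ => false).toSubring :=
      isNoetherianRing_of_ringEquiv _ e
    refine isDVR_ofPrime (chart k fun _ => false).toSubring _ (e z) (by simpa using hz.ne_zero) ?_
    have h1 : (chartPrime k (fun _ => false) (spanPrime hz)).asIdeal =
        (Ideal.span {z}).comap e.symm := rfl
    rw [h1, Ideal.comap_symm, Ideal.map_span, Set.image_singleton]
  mem := chartPoint_mem _ _

theorem hypersurface_toLocalSubring {z : MvPolynomial (Fin r) k} (hz : Prime z) :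
    (hypersurface hz).ring.toLocalSubring = chartPoint k (fun _ => false) (spanPrime hz) := rfl

theorem affineMap_mem_chartPoint (q : PrimeSpectrum (MvPolynomial (Fin r) k))
    (p : MvPolynomial (Fin r) k) :
    affineMap p ∈ (chartPoint k (fun _ => false) q).toSubring := by
  rw [← chartMap_affine]
  exact chartMap_mem_chartPoint _ _ _

theorem isAffine_hypersurface {z : MvPolynomial (Fin r) k} (hz : Prime z) :
    (hypersurface hz).IsAffine := fun _ =>
  affineMap_mem_chartPoint (spanPrime hz) _

theorem PrimeDivisor.IsAffine.affineMap_mem {Y : PrimeDivisor (P1Pow k r)} (hY : Y.IsAffine)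
    (p : MvPolynomial (Fin r) k) : affineMap p ∈ Y.ring := by
  obtain ⟨q, hq⟩ := exists_chartPoint_of_coord_mem Y.mem (fun _ => false) hY
  change _ ∈ Y.ring.toLocalSubring.toSubring
  rw [hq]
  exact affineMap_mem_chartPoint q p

theorem PrimeDivisor.IsAffine.eq_hypersurface {Y : PrimeDivisor (P1Pow k r)} (hY : Y.IsAffine)
    {z : MvPolynomial (Fin r) k} (hz : Prime z)
    (hv : Vanishes Y.ring.toLocalSubring (affineMap z)) : Y = hypersurface hz := by
  apply PrimeDivisor.ext_ring
  apply ValuationSubring.toSubring_injective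
  exact congrArg LocalSubring.toSubring (Y.eq_chartPoint (s := fun _ => false) hY hz
    (by rwa [chartMap_affine]))

/-- If no prime polynomial vanished on `Y`, unique factorization would make every nonzero polynomial
a unit along `Y`. But a uniformizer is a quotient of polynomials, and its numerator vanishes on `Y`.
-/
theorem PrimeDivisor.IsAffine.exists_eq_hypersurface {Y : PrimeDivisor (P1Pow k r)}
    (hY : Y.IsAffine) : ∃ (z : MvPolynomial (Fin r) k) (hz : Prime z), Y = hypersurface hz := by
  by_contra! hc
  have hprime : ∀ z : MvPolynomial (Fin r) k, Prime z →
      ¬ Vanishes Y.ring.toLocalSubring (affineMap z) := fun z hz hv =>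
    hc z hz (hY.eq_hypersurface hz hv)
  have hall : ∀ p : MvPolynomial (Fin r) k, p ≠ 0 →
      ¬ Vanishes Y.ring.toLocalSubring (affineMap p) := by
    intro p
    induction p using UniqueFactorizationMonoid.induction_on_prime with
    | h₁ => exact fun h => absurd rfl h
    | h₂ x hx =>
      intro h0 hv
      obtain ⟨y, hy⟩ := hx.exists_right_inv
      apply not_vanishes_one Y.ring.toLocalSubring
      rw [← map_one affineMap, ← hy, map_mul]
      exact hv.mul_right (hY.affineMap_mem y)
    | h₃ a p ha hp ih =>
      intro h0 hv
      rw [map_mul, vanishes_mul_iff (hY.affineMap_mem p) (hY.affineMap_mem a)] at hv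
      exact hv.elim (hprime p hp) (ih ha)
  obtain ⟨ϖ, hϖ⟩ := IsDiscreteValuationRing.exists_irreducible Y.ring
  have hv : Vanishes Y.ring.toLocalSubring (ϖ : FunField k r) :=
    ⟨ϖ, (IsLocalRing.mem_maximalIdeal _).2 hϖ.not_isUnit, rfl⟩
  obtain ⟨a, b, hb, -, hab⟩ := exists_reduced (ϖ : FunField k r)
  have h0 : (ϖ : FunField k r) ≠ 0 := fun h => hϖ.ne_zero (Subtype.ext h)
  have ha : a ≠ 0 := by
    rintro rfl
    exact h0 (by rw [hab]; simp)
  refine hall a ha ?_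
  have := hv.mul_right (hY.affineMap_mem b)
  rwa [hab, div_mul_cancel₀ _ (affineMap_ne_zero hb)] at this

theorem PrimeDivisor.IsAffine.ord_prime {Y : PrimeDivisor (P1Pow k r)} (hY : Y.IsAffine)
    {z : MvPolynomial (Fin r) k} (hz : Prime z) [Decidable (hypersurface hz = Y)] :
    Y.ord (affineMap z) = if hypersurface hz = Y then 1 else 0 := by
  split_ifs with h
  · rw [← h, ← chartMap_affine]
    exact PrimeDivisor.ord_chartMap_prime _ hz (hypersurface_toLocalSubring hz)
  · refine Y.ord_eq_zero_of_mem (hY.affineMap_mem z) ?_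
    refine inv_mem_of_not_vanishes (P := Y.ring.toLocalSubring) (hY.affineMap_mem z) fun hv => ?_
    exact h (hY.eq_hypersurface hz hv).symm

theorem PrimeDivisor.IsAffine.ord_nonneg {Y : PrimeDivisor (P1Pow k r)} (hY : Y.IsAffine)
    (p : MvPolynomial (Fin r) k) : 0 ≤ Y.ord (affineMap p) :=
  Y.ord_nonneg_of_mem (hY.affineMap_mem p)

theorem ord_hypersurface_neg {a b z : MvPolynomial (Fin r) k} (hb : b ≠ 0) (hab : IsRelPrime a b)
    (hz : Prime z) (hzb : z ∣ b) : (hypersurface hz).ord (affineMap a / affineMap b) < 0 := by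
  classical
  have hY := isAffine_hypersurface hz
  have hza : ¬ z ∣ a := fun h => hz.not_isUnit (hab h hzb)
  have ha : a ≠ 0 := by
    rintro rfl
    exact hza (dvd_zero z)
  rw [PrimeDivisor.ord_div _ (affineMap_ne_zero ha) (affineMap_ne_zero hb)]
  have h1 : (hypersurface hz).ord (affineMap a) = 0 := by
    refine PrimeDivisor.ord_eq_zero_of_mem _ (hY.affineMap_mem a) ?_
    refine inv_mem_of_not_vanishes (P := (hypersurface hz).ring.toLocalSubring)
      (hY.affineMap_mem a) ?_
    rw [hypersurface_toLocalSubring, ← chartMap_affine, vanishes_chartPoint, mem_spanPrime]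
    exact hza
  obtain ⟨c, rfl⟩ := hzb
  rw [map_mul, PrimeDivisor.ord_mul _ (affineMap_ne_zero (left_ne_zero_of_mul hb))
    (affineMap_ne_zero (right_ne_zero_of_mul hb)), hY.ord_prime hz, if_pos rfl, h1]
  have := hY.ord_nonneg c
  omega

/-- In a reduced fraction every prime factor of the denominator produces a pole, so a function
without poles on the chart has a unit as denominator. -/
theorem exists_affineMap_eq {f : FunField k r}
    (h : ∀ Y : PrimeDivisor (P1Pow k r), Y.IsAffine → 0 ≤ Y.ord f) :
    ∃ p, f = affineMap p := by
  obtain ⟨a, b, hb, hab, rfl⟩ := exists_reduced f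
  have hu : IsUnit b := by
    by_contra hu
    obtain ⟨z, hz, hzb⟩ := WfDvdMonoid.exists_irreducible_factor hu hb
    exact absurd (h _ (isAffine_hypersurface hz.prime))
      (not_le.2 (ord_hypersurface_neg hb hab hz.prime hzb))
  obtain ⟨c, hc⟩ := hu.exists_right_inv
  refine ⟨a * c, ?_⟩
  rw [div_eq_iff (affineMap_ne_zero hb), ← map_mul, mul_assoc, mul_comm c, hc, mul_one]

/-- The local form of the previous argument: if the reduced denominator lies in the prime ideal `q`,
so does one of its prime factors, which gives a pole through the point. -/
theorem mem_chartPoint_of_ord_nonneg {q : PrimeSpectrum (MvPolynomial (Fin r) k)}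
    {f : FunField k r} (h : ∀ Y : PrimeDivisor (P1Pow k r), Y.IsAffine →
      Y.Through (chartPoint k (fun _ => false) q) → 0 ≤ Y.ord f) :
    f ∈ (chartPoint k (fun _ => false) q).toSubring := by
  obtain ⟨a, b, hb, hab, rfl⟩ := exists_reduced f
  refine div_mem_chartPoint fun hbq => ?_
  obtain ⟨z, hz, hzb, hzq⟩ : ∃ z, Prime z ∧ z ∣ b ∧ z ∈ q.asIdeal := by
    clear hab h
    induction b using UniqueFactorizationMonoid.induction_on_prime with
    | h₁ => exact absurd rfl hb
    | h₂ x hx => exact absurd (Ideal.eq_top_of_isUnit_mem _ hbq hx) q.2.ne_top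
    | h₃ b p hb' hp ih =>
      rcases q.2.mem_or_mem hbq with h1 | h1
      · exact ⟨p, hp, dvd_mul_right _ _, h1⟩
      · obtain ⟨z, hz, hzb, hzq⟩ := ih hb' h1
        exact ⟨z, hz, hzb.mul_left _, hzq⟩
  refine absurd (h _ (isAffine_hypersurface hz) ?_)
    (not_le.2 (ord_hypersurface_neg hb hab hz hzb))
  intro x hx
  obtain ⟨c, d, hd, rfl⟩ := mem_chartPoint.1 hx
  exact mem_chartPoint.2 ⟨c, d, fun h => hd (Ideal.mem_of_dvd _ ((mem_spanPrime hz).1 h) hzq), rfl⟩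

/-- Affine space has trivial divisor class group. The orders of `H` along the `E_i` are not
prescribed; they are absorbed later into the degree bounds. -/
theorem exists_ord_eq_divisor (G : Divisor (P1Pow k r)) : ∃ H : FunField k r, H ≠ 0 ∧
    ∀ Y : PrimeDivisor (P1Pow k r), Y.IsAffine → Y.ord H = G Y := by
  classical
  have hz : ∀ Y : PrimeDivisor (P1Pow k r), ∃ f : FunField k r, f ≠ 0 ∧ (Y.IsAffine →
      ∀ Z : PrimeDivisor (P1Pow k r), Z.IsAffine → Z.ord f = if Y = Z then 1 else 0) := by
    intro Y
    by_cases hY : Y.IsAffine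
    · obtain ⟨z, hz, rfl⟩ := hY.exists_eq_hypersurface
      exact ⟨affineMap z, affineMap_ne_zero hz.ne_zero, fun _ Z hZ => hZ.ord_prime hz⟩
    · exact ⟨1, one_ne_zero, fun h => absurd h hY⟩
  choose f hf0 hf using hz
  refine ⟨∏ Y ∈ G.support.filter (·.IsAffine), f Y ^ G Y,
    Finset.prod_ne_zero_iff.2 fun Y _ => zpow_ne_zero _ (hf0 Y), fun Z hZ => ?_⟩
  rw [PrimeDivisor.ord_prod _ _ _ fun Y _ => zpow_ne_zero _ (hf0 Y)]
  rw [Finset.sum_congr rfl (g := fun Y => if Y = Z then G Y else 0)]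
  · rw [Finset.sum_ite_eq']
    simp only [Finset.mem_filter, hZ, and_true, Finsupp.mem_support_iff]
    split_ifs with h
    · rfl
    · exact (not_not.1 h).symm
  · intro Y hY
    rw [PrimeDivisor.ord_zpow, hf Y (Finset.mem_filter.1 hY).2 Z hZ]
    simp

/-- The numerator of the reduced fraction cuts out the divisor of zeros on the chart, because
numerator and denominator never vanish along a common divisor. -/
theorem exists_ord_eq_max {θ : FunField k r} (hθ : θ ≠ 0) : ∃ H : FunField k r, H ≠ 0 ∧
    ∀ Y : PrimeDivisor (P1Pow k r), Y.IsAffine → Y.ord H = max (Y.ord θ) 0 := by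
  classical
  obtain ⟨a, b, hb, hab, rfl⟩ := exists_reduced θ
  have ha : a ≠ 0 := by
    rintro rfl
    simp at hθ
  refine ⟨affineMap a, affineMap_ne_zero ha, fun Y hY => ?_⟩
  have h1 := hY.ord_nonneg a
  have h2 := hY.ord_nonneg b
  have h3 := Y.ord_div (affineMap_ne_zero ha) (affineMap_ne_zero hb)
  rcases h2.eq_or_lt with h2 | h2
  · omega
  · obtain ⟨z, hz, rfl⟩ := hY.exists_eq_hypersurface
    have hzb : z ∣ b := by
      by_contra hzb
      apply h2.ne
      symm
      refine PrimeDivisor.ord_eq_zero_of_mem _ (hY.affineMap_mem b) ?_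
      refine inv_mem_of_not_vanishes (P := (hypersurface hz).ring.toLocalSubring)
        (hY.affineMap_mem b) ?_
      rw [hypersurface_toLocalSubring, ← chartMap_affine, vanishes_chartPoint, mem_spanPrime]
      exact hzb
    have h4 := ord_hypersurface_neg hb hab hz hzb
    have h5 : (hypersurface hz).ord (affineMap a) = 0 := by
      by_contra h5
      apply h5
      refine PrimeDivisor.ord_eq_zero_of_mem _ (hY.affineMap_mem a) ?_
      refine inv_mem_of_not_vanishes (P := (hypersurface hz).ring.toLocalSubring)
        (hY.affineMap_mem a) ?_
      rw [hypersurface_toLocalSubring, ← chartMap_affine, vanishes_chartPoint, mem_spanPrime]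
      exact fun hza => hz.not_isUnit (hab hza hzb)
    omega

end PrimeDivisors

/-! ### Orders along the `E_i` as degrees, and Riemann-Roch spaces as polynomial spaces. -/

section Degrees

variable {k : Type*} [Field k] {r : ℕ}

/-- Clearing the powers of `1 / x_i`. The bound of the degree by the same `N` is what gives the
contradiction in `ord_polarDivisor_affineMap`. -/
theorem exists_coord_pow_mul_chartMap (i : Fin r) (v : MvPolynomial (Fin r) k) :
    ∃ (N : ℕ) (g : MvPolynomial (Fin r) k), g.degreeOf i ≤ N ∧
      coord k i ^ N * chartMap k (invChart i) v = affineMap g := by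
  induction v using MvPolynomial.induction_on with
  | C c =>
    refine ⟨0, MvPolynomial.C c, by simp, ?_⟩
    rw [← chartMap_affine]
    simp [chartMap]
  | add p q hp hq =>
    obtain ⟨N, g, hg, h⟩ := hp
    obtain ⟨M, g', hg', h'⟩ := hq
    refine ⟨N + M, MvPolynomial.X i ^ M * g + MvPolynomial.X i ^ N * g', ?_, ?_⟩
    · refine (MvPolynomial.degreeOf_add_le _ _ _).trans (max_le ?_ ?_)
      · refine (MvPolynomial.degreeOf_mul_le _ _ _).trans ?_
        have := MvPolynomial.degreeOf_pow_le i (MvPolynomial.X i : MvPolynomial (Fin r) k) M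
        rw [MvPolynomial.degreeOf_X_self] at this
        omega
      · refine (MvPolynomial.degreeOf_mul_le _ _ _).trans ?_
        have := MvPolynomial.degreeOf_pow_le i (MvPolynomial.X i : MvPolynomial (Fin r) k) N
        rw [MvPolynomial.degreeOf_X_self] at this
        omega
    · rw [map_add, map_add, map_mul, map_mul, ← h, ← h', map_pow, map_pow]
      change _ = coord k i ^ M * _ + coord k i ^ N * _
      ring
  | mul_X p j hp =>
    obtain ⟨N, g, hg, h⟩ := hp
    by_cases hj : j = i
    · subst hj
      refine ⟨N + 1, g, by omega, ?_⟩
      rw [map_mul, chartMap_X, chartCoord_invChart_self, ← h]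
      have := coord_ne_zero k j
      field_simp
      ring
    · refine ⟨N, g * MvPolynomial.X j, ?_, ?_⟩
      · refine (MvPolynomial.degreeOf_mul_le _ _ _).trans ?_
        rw [MvPolynomial.degreeOf_X_of_ne (Ne.symm hj)]
        omega
      · rw [map_mul, chartMap_X, chartCoord_invChart_of_ne hj, map_mul, ← h]
        change _ = _ * coord k j
        ring

theorem exists_chartMap_eq (i : Fin r) {p : MvPolynomial (Fin r) k} {d : ℕ}
    (hd : p.degreeOf i ≤ d) :
    ∃ v, affineMap p * (coord k i)⁻¹ ^ d = chartMap k (invChart i) v := by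
  suffices h : affineMap p * (coord k i)⁻¹ ^ d ∈ (chartMap k (invChart i)).range by
    obtain ⟨v, hv⟩ := h
    exact ⟨v, hv.symm⟩
  rw [p.as_sum, map_sum, Finset.sum_mul]
  refine sum_mem fun e he => ?_
  have hei : e i ≤ d := (MvPolynomial.degreeOf_le_iff.1 hd) e he
  rw [← chartMap_affine]
  refine ⟨MvPolynomial.C (p.coeff e) * (MvPolynomial.X i ^ (d - e i) *
    ∏ j ∈ Finset.univ.erase i, MvPolynomial.X j ^ e j), ?_⟩
  have h1 : chartMap k (fun _ => false) (MvPolynomial.monomial e (p.coeff e)) =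
      algebraMap k _ (p.coeff e) * ∏ j, coord k j ^ e j := by
    rw [chartMap, MvPolynomial.aeval_monomial, Finsupp.prod_fintype _ _ (by simp)]
    simp [chartCoord]
  change chartMap k (invChart i) _ = _
  rw [h1, map_mul, map_mul, map_prod, map_pow, chartMap_X, chartCoord_invChart_self,
    ← Finset.mul_prod_erase _ _ (Finset.mem_univ i)]
  rw [Finset.prod_congr rfl (g := fun j => coord k j ^ e j) fun j hj => by
    rw [map_pow, chartMap_X, chartCoord_invChart_of_ne (Finset.ne_of_mem_erase hj)]]
  rw [show chartMap k (invChart i) (MvPolynomial.C (p.coeff e)) = algebraMap k _ (p.coeff e) by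
    simp [chartMap]]
  have h0 := coord_ne_zero k i
  obtain ⟨m, rfl⟩ := Nat.exists_eq_add_of_le hei
  rw [Nat.add_sub_cancel_left, pow_add, inv_pow, inv_pow]
  field_simp

/-- With `d` the degree of `p` in `x_i`, the function `p * x_i ^ (-d)` is a polynomial in the
coordinates of `invChart i`, and it is a unit along `E_i`. -/
theorem ord_polarDivisor_affineMap (i : Fin r) {p : MvPolynomial (Fin r) k} (hp : p ≠ 0) :
    (polarDivisor k i).ord (affineMap p) = -(p.degreeOf i : ℤ) := by
  set Y := polarDivisor k i
  have hx := coord_ne_zero k i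
  have hp0 := affineMap_ne_zero hp
  obtain ⟨v, hv⟩ := exists_chartMap_eq i (le_refl (p.degreeOf i))
  have hmem : chartMap k (invChart i) v ∈ Y.ring :=
    chartMap_mem_chartPoint (invChart i) (spanPrime (MvPolynomial.X_prime (i := i))) v
  have hn : ¬ Vanishes Y.ring.toLocalSubring (chartMap k (invChart i) v) := by
    rw [polarDivisor_toLocalSubring, vanishes_chartPoint, mem_spanPrime]
    -- Divisibility by `1 / x_i` would give `p * x_i ^ (N + 1) = g * x_i ^ d` with `g` of degree at
    -- most `N` in `x_i`; the degrees `d + N + 1` and at most `N + d` disagree.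
    rintro ⟨w, rfl⟩
    obtain ⟨N, g, hg, hw⟩ := exists_coord_pow_mul_chartMap i w
    rw [map_mul, chartMap_X, chartCoord_invChart_self] at hv
    have e : p * MvPolynomial.X i ^ (N + 1) = g * MvPolynomial.X i ^ p.degreeOf i := by
      apply IsFractionRing.injective (MvPolynomial (Fin r) k) (FunField k r)
      rw [map_mul, map_mul, map_pow, map_pow]
      change affineMap p * coord k i ^ (N + 1) = affineMap g * coord k i ^ _
      rw [← hw]
      rw [inv_pow] at hv
      field_simp at hv
      rw [pow_succ, ← mul_assoc, mul_right_comm, hv]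
      ring
    have hg0 : g ≠ 0 := by
      rintro rfl
      rw [zero_mul] at e
      exact mul_ne_zero hp (pow_ne_zero _ (MvPolynomial.X_ne_zero i)) e
    have e' := congrArg (MvPolynomial.degreeOf i) e
    rw [MvPolynomial.degreeOf_mul_eq hp (pow_ne_zero _ (MvPolynomial.X_ne_zero i)),
      MvPolynomial.degreeOf_mul_eq hg0 (pow_ne_zero _ (MvPolynomial.X_ne_zero i)),
      MvPolynomial.degreeOf_pow_eq i _ _ (MvPolynomial.X_ne_zero i),
      MvPolynomial.degreeOf_pow_eq i _ _ (MvPolynomial.X_ne_zero i),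
      MvPolynomial.degreeOf_X_self] at e'
    omega
  have h1 := Y.ord_eq_zero_of_mem hmem
    (inv_mem_of_not_vanishes (P := Y.ring.toLocalSubring) hmem hn)
  rw [← hv, Y.ord_mul hp0 (pow_ne_zero _ (inv_ne_zero hx)), Y.ord_pow,
    ord_polarDivisor_inv_coord] at h1
  omega

variable (k) in
/-- The polynomials of degree at most `n i` in the `i`-th variable. -/
def polySpace (n : Fin r → ℤ) : Set (MvPolynomial (Fin r) k) :=
  {p | ∀ e ∈ p.support, ∀ i, (e i : ℤ) ≤ n i}

/-- The restriction `p ≠ 0` matters when some bound is negative: then `polySpace` consists of `0`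
alone, whereas `degreeOf` assigns `0` the degree `0`. -/
theorem mem_polySpace_iff {n : Fin r → ℤ} {p : MvPolynomial (Fin r) k} (hp : p ≠ 0) :
    p ∈ polySpace k n ↔ ∀ i, (p.degreeOf i : ℤ) ≤ n i := by
  obtain ⟨e, he⟩ := MvPolynomial.support_nonempty.2 hp
  constructor
  · intro h i
    have h1 : 0 ≤ n i := (Int.natCast_nonneg _).trans (h e he i)
    have : p.degreeOf i ≤ (n i).toNat := MvPolynomial.degreeOf_le_iff.2 fun e he => by
      have := h e he i
      omega
    omega
  · intro h e he i
    have := MvPolynomial.monomial_le_degreeOf i he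
    have := h i
    omega

/-- The conditions along affine divisors say that `f * H` has no poles on the chart, so it is a
polynomial; the conditions along the `E_i` are bounds on its degrees. -/
theorem mem_rrSpace_iff {W : PrimeDivisor (P1Pow k r) → ℤ} {H : FunField k r} (hH : H ≠ 0)
    (hW : ∀ Y : PrimeDivisor (P1Pow k r), Y.IsAffine → Y.ord H = W Y) {f : FunField k r} :
    f ∈ rrSpace W ↔ ∃ p ∈ polySpace k fun i => W (polarDivisor k i) - (polarDivisor k i).ord H,
      f = affineMap p / H := by
  constructor
  · rintro (rfl | h)
    · exact ⟨0, by simp [polySpace], by simp⟩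
    by_cases hf : f = 0
    · exact ⟨0, by simp [polySpace], by simp [hf]⟩
    obtain ⟨p, hp⟩ : ∃ p, f * H = affineMap p := exists_affineMap_eq fun Y hY => by
      rw [Y.ord_mul hf hH, hW Y hY]
      exact h Y
    have hp0 : p ≠ 0 := by
      rintro rfl
      rw [map_zero] at hp
      exact mul_ne_zero hf hH hp
    refine ⟨p, (mem_polySpace_iff hp0).2 fun i => ?_, by rw [← hp, mul_div_cancel_right₀ _ hH]⟩
    have h1 := h (polarDivisor k i)
    have h2 := ord_polarDivisor_affineMap i hp0
    rw [← hp, PrimeDivisor.ord_mul _ hf hH] at h2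
    omega
  · rintro ⟨p, hp, rfl⟩
    by_cases hp0 : p = 0
    · left
      simp [hp0]
    right
    intro Y
    rw [Y.ord_div (affineMap_ne_zero hp0) hH]
    rcases Y.isAffine_or_eq_polarDivisor with hY | ⟨i, rfl⟩
    · have := hY.ord_nonneg p
      rw [hW Y hY]
      omega
    · have h1 := (mem_polySpace_iff hp0).1 hp i
      rw [ord_polarDivisor_affineMap i hp0]
      omega

end Degrees

/-! ### The combinatorial core: the dual is no weighted evaluation code. -/

section Evaluation

variable {k : Type*} [Field k] [Fintype k] {r : ℕ}

/-- On each line in direction `j` the factor `φ` is constant and every monomial contributes a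
multiple of `∑ t ^ e j`, which is zero for `e j < q - 1`. -/
theorem sum_eval_mul_eq_zero {p : MvPolynomial (Fin r) k} {j : Fin r}
    (hp : ∀ e ∈ p.support, e j < Fintype.card k - 1) (φ : (Fin r → k) → k)
    (hφ : ∀ α t, φ (Function.update α j t) = φ α) :
    ∑ α, MvPolynomial.eval α p * φ α = 0 := by
  classical
  have h1 : ∀ α, MvPolynomial.eval α p * φ α =
      ∑ e ∈ p.support, p.coeff e * ((∏ i, α i ^ e i) * φ α) := by
    intro α
    rw [MvPolynomial.eval_eq', Finset.sum_mul]
    exact Finset.sum_congr rfl fun e _ => by ring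
  simp_rw [h1]
  rw [Finset.sum_comm]
  refine Finset.sum_eq_zero fun e he => ?_
  rw [← Finset.mul_sum]
  refine mul_eq_zero_of_right _ ?_
  rw [← (Equiv.funSplitAt j k).symm.sum_comp, Fintype.sum_prod_type_right]
  refine Finset.sum_eq_zero fun β _ => ?_
  have h2 : ∀ t, (Equiv.funSplitAt j k).symm (t, β) =
      Function.update ((Equiv.funSplitAt j k).symm (0, β)) j t := by
    intro t
    ext i
    by_cases hi : i = j
    · subst hi
      simp [Equiv.funSplitAt, Equiv.piSplitAt]
    · simp [Equiv.funSplitAt, Equiv.piSplitAt, hi]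
  have h3 : ∀ t, (∏ i, ((Equiv.funSplitAt j k).symm (t, β)) i ^ e i) *
      φ ((Equiv.funSplitAt j k).symm (t, β)) = t ^ e j *
      ((∏ i ∈ Finset.univ.erase j, ((Equiv.funSplitAt j k).symm (0, β)) i ^ e i) *
      φ ((Equiv.funSplitAt j k).symm (0, β))) := by
    intro t
    rw [h2 t, hφ, ← Finset.mul_prod_erase _ _ (Finset.mem_univ j), Function.update_self, mul_assoc]
    congr 2
    refine Finset.prod_congr rfl fun i hi => ?_
    rw [Function.update_of_ne (Finset.ne_of_mem_erase hi)]
  simp_rw [h3]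
  rw [← Finset.sum_mul, FiniteField.sum_pow_lt_card_sub_one k _ (hp e he), zero_mul]

theorem dualCode_ne_evaluation (hr : 2 ≤ r) {m : Fin r → ℕ} (hm : ∀ i, m i + 2 < Fintype.card k)
    {C : Set ((Fin r → k) → k)} (h1 : 1 ∈ C)
    (hC : ∀ v ∈ C, ∃ p ∈ polySpace k fun i => (m i : ℤ), ∀ α, v α = MvPolynomial.eval α p)
    (n : Fin r → ℤ) (w : (Fin r → k) → k) (hw : ∀ α, w α ≠ 0) :
    dualCode C ≠ {v | ∃ p ∈ polySpace k n, ∀ α, v α = w α * MvPolynomial.eval α p} := by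
  classical
  intro h
  by_cases hn : ∀ i, (Fintype.card k : ℤ) - 1 ≤ n i
  -- Every function on `k^r` is given by a polynomial of degree at most `q - 1` in each variable, so
  -- the weighted code is everything. The indicator of the origin would then be orthogonal to `1`,
  -- but their product is `1`. The value `(w 0)⁻¹` cancels the weight.
  · have hmem : Pi.single 0 1 ∈ dualCode C := by
      rw [h]
      have hs : (Pi.single 0 (w 0)⁻¹ : (Fin r → k) → k) ∈
          (MvPolynomial.restrictDegree (Fin r) k (Fintype.card k - 1)).map
            (MvPolynomial.evalₗ k (Fin r)) := by
        rw [MvPolynomial.map_restrict_dom_evalₗ]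
        trivial
      obtain ⟨p, hp, hpe⟩ := hs
      refine ⟨p, fun e he i => ?_, fun α => ?_⟩
      · have h2 := (MvPolynomial.mem_restrictDegree _ _ _).1 hp e he i
        have h3 := hn i
        have h4 := Fintype.card_pos (α := k)
        omega
      · have h2 : MvPolynomial.eval α p = (Pi.single 0 (w 0)⁻¹ : (Fin r → k) → k) α :=
          congrFun hpe α
        rw [h2]
        by_cases hα : α = 0
        · subst hα
          simp [hw]
        · simp [Pi.single_eq_of_ne hα]
    have := hmem 1 h1
    simp at this
  · push Not at hn
    obtain ⟨i, hi⟩ := hn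
    obtain ⟨j, hj⟩ : ∃ j : Fin r, j ≠ i := by
      have : Nontrivial (Fin r) := Fin.nontrivial_iff_two_le.2 hr
      exact exists_ne i
    -- The indicator of `α i = 0` does not depend on `α j`, and codewords have degree at most `m j <
    -- q - 1` in that variable.
    have hmem : (fun α : Fin r → k => if α i = 0 then (1 : k) else 0) ∈ dualCode C := by
      intro v hv
      obtain ⟨p, hp, hpv⟩ := hC v hv
      rw [dotProduct]
      simp_rw [hpv]
      refine sum_eval_mul_eq_zero (j := j) (fun e he => ?_) _ fun α t => ?_
      · have h2 : (e j : ℤ) ≤ m j := hp e he j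
        have h3 := hm j
        omega
      · rw [Function.update_of_ne hj.symm]
    rw [h] at hmem
    obtain ⟨p, hp, hpv⟩ := hmem
    -- Here `φ` is the indicator of the `i`-th axis. On this axis `p` vanishes off the origin
    -- because `w` has no zeros, so the sum reduces to the value of `p` at the origin, which must be
    -- nonzero.
    have h2 := sum_eval_mul_eq_zero (p := p) (j := i) (fun e he => by
      have := hp e he i
      omega) (fun α => if ∀ l, l ≠ i → α l = 0 then 1 else 0) (fun α t => by
      refine if_congr (forall_congr' fun l => imp_congr_right fun hl => ?_) rfl rfl
      rw [Function.update_of_ne hl])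
    rw [Finset.sum_eq_single 0] at h2
    · have h3 := hpv 0
      simp only [ne_eq, Pi.zero_apply, implies_true, if_true, mul_one] at h2 h3
      rw [h2, mul_zero] at h3
      exact one_ne_zero h3
    · intro α _ hα
      split_ifs with hl
      · have hαi : α i ≠ 0 := fun hαi => hα (by
          ext l
          by_cases hli : l = i
          · rw [hli, hαi, Pi.zero_apply]
          · exact hl l hli)
        have h3 := hpv α
        simp only [hαi, if_false] at h3
        rw [mul_one, (mul_eq_zero.1 h3.symm).resolve_left (hw α)]
      · rw [mul_zero]
    · exact fun h => absurd (Finset.mem_univ _) h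

end Evaluation

/-! ### Values of functions at rational points. -/

section Values

variable {k : Type*} [Field k] {r : ℕ}

theorem affinePoint_eq (α : Fin r → k) : affinePoint k α =
    chartPoint k (fun _ => false) ⟨RingHom.ker (MvPolynomial.eval α), RingHom.ker_isPrime _⟩ := rfl

theorem affinePoint_mem (α : Fin r → k) : affinePoint k α ∈ P1Pow k r := chartPoint_mem _ _

theorem algebraMap_mem_affinePoint (α : Fin r → k) (c : k) :
    algebraMap k _ c ∈ (affinePoint k α).toSubring := algebraMap_mem_of_mem (affinePoint_mem α) c

theorem affineMap_mem_affinePoint (α : Fin r → k) (p : MvPolynomial (Fin r) k) :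
    affineMap p ∈ (affinePoint k α).toSubring := affineMap_mem_chartPoint _ p

theorem vanishes_affineMap {α : Fin r → k} {p : MvPolynomial (Fin r) k} :
    Vanishes (affinePoint k α) (affineMap p) ↔ MvPolynomial.eval α p = 0 := by
  rw [affinePoint_eq, ← chartMap_affine, vanishes_chartPoint]
  exact RingHom.mem_ker

theorem mem_affinePoint {α : Fin r → k} {x : FunField k r} :
    x ∈ (affinePoint k α).toSubring ↔ ∃ a b : MvPolynomial (Fin r) k,
      MvPolynomial.eval α b ≠ 0 ∧ x = affineMap a / affineMap b := by
  rw [affinePoint_eq, mem_chartPoint]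
  simp_rw [chartMap_affine]
  rfl

theorem algebraMap_eq_affineMap_C (c : k) :
    algebraMap k (FunField k r) c = affineMap (MvPolynomial.C c) := by
  rw [← chartMap_affine]
  simp [chartMap]

theorem vanishes_algebraMap {α : Fin r → k} {c : k} :
    Vanishes (affinePoint k α) (algebraMap k _ c) ↔ c = 0 := by
  rw [algebraMap_eq_affineMap_C, vanishes_affineMap, MvPolynomial.eval_C]

theorem HasValue.mem {α : Fin r → k} {f : FunField k r} {c : k}
    (h : HasValue k (affinePoint k α) f c) : f ∈ (affinePoint k α).toSubring := by
  have h1 : Vanishes (affinePoint k α) (f - algebraMap k _ c) := h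
  simpa using add_mem h1.mem (algebraMap_mem_affinePoint α c)

theorem HasValue.unique {α : Fin r → k} {f : FunField k r} {c d : k}
    (hc : HasValue k (affinePoint k α) f c) (hd : HasValue k (affinePoint k α) f d) : c = d := by
  have hc' : Vanishes (affinePoint k α) (f - algebraMap k _ c) := hc
  have hd' : Vanishes (affinePoint k α) (f - algebraMap k _ d) := hd
  have h := hd'.sub hc'
  rw [sub_sub_sub_cancel_left, ← map_sub, vanishes_algebraMap] at h
  exact sub_eq_zero.1 h

theorem hasValue_affineMap (α : Fin r → k) (p : MvPolynomial (Fin r) k) :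
    HasValue k (affinePoint k α) (affineMap p) (MvPolynomial.eval α p) := by
  change Vanishes _ _
  rw [algebraMap_eq_affineMap_C, ← map_sub, vanishes_affineMap]
  simp

theorem HasValue.mul {α : Fin r → k} {f g : FunField k r} {c d : k}
    (hc : HasValue k (affinePoint k α) f c) (hd : HasValue k (affinePoint k α) g d) :
    HasValue k (affinePoint k α) (f * g) (c * d) := by
  have hc' : Vanishes (affinePoint k α) (f - algebraMap k _ c) := hc
  have hd' : Vanishes (affinePoint k α) (g - algebraMap k _ d) := hd
  have h := (hc'.mul_right hd.mem).add (hd'.mul_left (algebraMap_mem_affinePoint α c))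
  change Vanishes _ _
  convert h using 1
  rw [map_mul]
  ring

theorem exists_hasValue {α : Fin r → k} {f : FunField k r}
    (hf : f ∈ (affinePoint k α).toSubring) : ∃ c, HasValue k (affinePoint k α) f c := by
  obtain ⟨a, b, hb, rfl⟩ := mem_affinePoint.1 hf
  refine ⟨MvPolynomial.eval α a / MvPolynomial.eval α b, ?_⟩
  have hb0 : affineMap b ≠ 0 := affineMap_ne_zero (by rintro rfl; simp at hb)
  have hbv : ¬ Vanishes (affinePoint k α) (affineMap b) := by rwa [vanishes_affineMap]
  have hinv := inv_mem_of_not_vanishes (affineMap_mem_affinePoint α b) hbv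
  have h1 : Vanishes (affinePoint k α)
      (affineMap (a - MvPolynomial.C (MvPolynomial.eval α a / MvPolynomial.eval α b) * b)) := by
    rw [vanishes_affineMap]
    simp [hb]
  change Vanishes _ _
  convert h1.mul_right hinv using 1
  rw [map_sub, map_mul, ← algebraMap_eq_affineMap_C]
  field_simp

theorem exists_hasValue_of_unit {α : Fin r → k} {f : FunField k r} (hf0 : f ≠ 0)
    (hf : f ∈ (affinePoint k α).toSubring) (hf' : f⁻¹ ∈ (affinePoint k α).toSubring) :
    ∃ c, c ≠ 0 ∧ HasValue k (affinePoint k α) f c := by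
  obtain ⟨c, hc⟩ := exists_hasValue hf
  refine ⟨c, ?_, hc⟩
  rintro rfl
  have hc' : Vanishes (affinePoint k α) (f - algebraMap k _ 0) := hc
  rw [map_zero, sub_zero] at hc'
  exact not_vanishes_of_inv_mem hf0 hf' hc'

/-- The Hartogs-type criterion applied to `f` and to `f⁻¹`. -/
theorem unit_of_ord_eq_zero {α : Fin r → k} {f : FunField k r}
    (h : ∀ Y : PrimeDivisor (P1Pow k r), Y.IsAffine → Y.Through (affinePoint k α) → Y.ord f = 0) :
    f ∈ (affinePoint k α).toSubring ∧ f⁻¹ ∈ (affinePoint k α).toSubring :=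
  ⟨mem_chartPoint_of_ord_nonneg fun Y hY hP => (h Y hY hP).ge,
    mem_chartPoint_of_ord_nonneg fun Y hY hP => by rw [Y.ord_inv, h Y hY hP, neg_zero]⟩

theorem eq_zero_of_not_inSupport {K : Type*} [Field K] {X : Set (LocalSubring K)} {G : Divisor X}
    {P : LocalSubring K} (h : ¬ InSupport G P) {Y : PrimeDivisor X} (hY : Y.Through P) :
    G Y = 0 := by
  by_contra hc
  exact h ⟨Y, hc, hY⟩

end Values

/-! ### Functional codes as weighted evaluation codes. -/

section Functional

variable {k : Type*} [Field k] {r : ℕ}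

/-- The weight is the value of `1 / H`, where `H` cuts out `G` on the chart; it is finite and
nonzero at the points of `𝒫` because the support of `G` avoids them. -/
theorem functionalCode_eq {G : Divisor (P1Pow k r)} [Fintype k]
    (hG : ∀ α, ¬ InSupport G (affinePoint k α)) :
    ∃ (n : Fin r → ℤ) (w : (Fin r → k) → k), (∀ α, w α ≠ 0) ∧ functionalCode k (affinePoint k) G =
      {v | ∃ p ∈ polySpace k n, ∀ α, v α = w α * MvPolynomial.eval α p} := by
  obtain ⟨H, hH, hW⟩ := exists_ord_eq_divisor G
  have hval : ∀ α, ∃ c, c ≠ 0 ∧ HasValue k (affinePoint k α) H⁻¹ c := by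
    intro α
    have hu := unit_of_ord_eq_zero (f := H) (α := α) fun Y hY hP => by
      rw [hW Y hY, eq_zero_of_not_inSupport (hG α) hP]
    exact exists_hasValue_of_unit (inv_ne_zero hH) hu.2 (by rw [inv_inv]; exact hu.1)
  choose w hw0 hw using hval
  refine ⟨fun i => G (polarDivisor k i) - (polarDivisor k i).ord H, w, hw0, ?_⟩
  have key : ∀ p α, HasValue k (affinePoint k α) (affineMap p / H)
      (w α * MvPolynomial.eval α p) := by
    intro p α
    rw [div_eq_inv_mul]
    exact (hw α).mul (hasValue_affineMap α p)
  ext v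
  constructor
  · rintro ⟨f, hf, hv⟩
    obtain ⟨p, hp, rfl⟩ := (mem_rrSpace_iff hH hW).1 hf
    exact ⟨p, hp, fun α => (hv α).unique (key p α)⟩
  · rintro ⟨p, hp, hv⟩
    exact ⟨_, (mem_rrSpace_iff hH hW).2 ⟨p, hp, rfl⟩, fun α => hv α ▸ key p α⟩

theorem polarSum_apply_polarDivisor (m : Fin r → ℕ) (i : Fin r) :
    (∑ i, Finsupp.single (polarDivisor k i) (m i : ℤ)) (polarDivisor k i) = m i := by
  rw [Finsupp.finsetSum_apply, Finset.sum_eq_single i]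
  · simp
  · intro j _ hj
    rw [Finsupp.single_eq_of_ne]
    exact fun h => hj (polarDivisor_injective h).symm
  · simp

theorem polarSum_apply_of_isAffine (m : Fin r → ℕ) {Y : PrimeDivisor (P1Pow k r)}
    (hY : Y.IsAffine) : (∑ i, Finsupp.single (polarDivisor k i) (m i : ℤ)) Y = 0 := by
  rw [Finsupp.finsetSum_apply]
  refine Finset.sum_eq_zero fun i _ => ?_
  rw [Finsupp.single_eq_of_ne]
  rintro rfl
  exact not_isAffine_polarDivisor i (hY i)

theorem mem_functionalCode_polarSum [Fintype k] (m : Fin r → ℕ) (v : (Fin r → k) → k) :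
    v ∈ functionalCode k (affinePoint k) (∑ i, Finsupp.single (polarDivisor k i) (m i : ℤ)) ↔
      ∃ p ∈ polySpace k fun i => (m i : ℤ), ∀ α, v α = MvPolynomial.eval α p := by
  have hW : ∀ Y : PrimeDivisor (P1Pow k r), Y.IsAffine → Y.ord (1 : FunField k r) =
      (∑ i, Finsupp.single (polarDivisor k i) (m i : ℤ)) Y := fun Y hY => by
    rw [polarSum_apply_of_isAffine m hY, Y.ord_one]
  have h1 := fun f => mem_rrSpace_iff one_ne_zero hW (f := f)
  simp_rw [polarSum_apply_polarDivisor, PrimeDivisor.ord_one, sub_zero, div_one] at h1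
  constructor
  · rintro ⟨f, hf, hv⟩
    obtain ⟨p, hp, rfl⟩ := (h1 f).1 hf
    exact ⟨p, hp, fun α => (hv α).unique (hasValue_affineMap α p)⟩
  · rintro ⟨p, hp, hv⟩
    exact ⟨_, (h1 _).2 ⟨p, hp, rfl⟩, fun α => hv α ▸ hasValue_affineMap α p⟩

theorem dualCode_functionalCode_ne [Fintype k] (hr : 2 ≤ r) {m : Fin r → ℕ}
    (hm : ∀ i, m i + 2 < Fintype.card k) (n : Fin r → ℤ) (w : (Fin r → k) → k)
    (hw : ∀ α, w α ≠ 0) :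
    dualCode (functionalCode k (affinePoint k)
      (∑ i, Finsupp.single (polarDivisor k i) (m i : ℤ))) ≠
      {v | ∃ p ∈ polySpace k n, ∀ α, v α = w α * MvPolynomial.eval α p} := by
  refine dualCode_ne_evaluation hr hm ?_ (fun v hv => (mem_functionalCode_polarSum m v).1 hv) n w hw
  rw [mem_functionalCode_polarSum]
  refine ⟨1, fun e he i => ?_, fun α => by simp⟩
  have he0 : e = 0 := by
    by_contra hc
    rw [MvPolynomial.mem_support_iff, MvPolynomial.coeff_one, if_neg (Ne.symm hc)] at he
    exact he rfl
  simp [he0]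

theorem not_isFunctionalCode_dualCode [Fintype k] (hr : 2 ≤ r) {m : Fin r → ℕ}
    (hm : ∀ i, m i + 2 < Fintype.card k) :
    ¬ IsFunctionalCode k (P1Pow k r) (affinePoint k)
      (dualCode (functionalCode k (affinePoint k)
        (∑ i, Finsupp.single (polarDivisor k i) (m i : ℤ)))) := by
  rintro ⟨G, hG, h⟩
  obtain ⟨n, w, hw, hGeq⟩ := functionalCode_eq hG
  exact dualCode_functionalCode_ne hr hm n w hw (h.trans hGeq)

end Functional

/-! ### Rational differentials of top degree. -/

section Forms

/-- As functions of the rows of `A` both sides are alternating, so it suffices to compare them on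
the permutations of the standard basis; the signs agree, and at the identity matrix both are `f v`.
-/
theorem _root_.AlternatingMap.map_sum_smul {R M N : Type*} [CommRing R] [AddCommGroup M]
    [Module R M] [AddCommGroup N] [Module R N] {n : ℕ} (f : M [⋀^Fin n]→ₗ[R] N)
    (A : Matrix (Fin n) (Fin n) R) (v : Fin n → M) :
    f (fun i => ∑ j, A i j • v j) = A.det • f v := by
  have key : f.compLinearMap (Fintype.linearCombination R v) =
      (LinearMap.toSpanSingleton R N (f v)).compAlternatingMap Matrix.detRowAlternating := by
    refine Module.Basis.ext_alternating (Pi.basisFun R (Fin n)) fun σ hσ => ?_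
    obtain ⟨τ, rfl⟩ : ∃ τ : Equiv.Perm (Fin n), ⇑τ = σ :=
      ⟨Equiv.ofBijective σ (Finite.injective_iff_bijective.1 hσ), rfl⟩
    change (f.compLinearMap _) (⇑(Pi.basisFun R (Fin n)) ∘ τ) =
      (LinearMap.compAlternatingMap _ _) (⇑(Pi.basisFun R (Fin n)) ∘ τ)
    rw [AlternatingMap.map_perm, AlternatingMap.map_perm]
    congr 1
    have h1 : (fun i => Fintype.linearCombination R v (Pi.basisFun R (Fin n) i)) = v := by
      ext i
      simp [Fintype.linearCombination_apply, Pi.single_apply]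
    have h2 : Matrix.detRowAlternating (⇑(Pi.basisFun R (Fin n))) = (1 : R) := by
      have h3 : Matrix.of (fun i => Pi.basisFun R (Fin n) i) = 1 := by
        ext i j
        simp [Matrix.one_apply, Pi.single_apply, eq_comm]
      exact (congrArg Matrix.det h3).trans Matrix.det_one
    rw [LinearMap.compAlternatingMap_apply, h2, LinearMap.toSpanSingleton_apply, one_smul,
      AlternatingMap.compLinearMap_apply]
    exact congrArg f h1
  exact congrArg (fun g : (Fin n → R) [⋀^Fin n]→ₗ[R] N => g A) key

variable {k : Type*} [Field k] {r : ℕ}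

variable (k) in
/-- The differential of a rational function. -/
noncomputable abbrev dK : Derivation k (FunField k r) (Ω[FunField k r⁄k]) :=
  KaehlerDifferential.D k (FunField k r)

theorem dK_chartMap (s : Fin r → Bool) (p : MvPolynomial (Fin r) k) :
    dK k (chartMap k s p) =
      ∑ j, chartMap k s (MvPolynomial.pderiv j p) • dK k (chartCoord k s j) := by
  classical
  induction p using MvPolynomial.induction_on with
  | C c =>
    have : chartMap k s (MvPolynomial.C c) = algebraMap k _ c := by simp [chartMap]
    rw [this, Derivation.map_algebraMap]
    simp
  | add p q hp hq => simp [map_add, add_smul, Finset.sum_add_distrib, hp, hq]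
  | mul_X p i hp =>
    rw [map_mul, Derivation.leibniz, hp]
    simp only [Derivation.leibniz, smul_eq_mul, map_add, map_mul, chartMap_X, add_smul,
      Finset.sum_add_distrib, Finset.smul_sum, smul_smul, MvPolynomial.pderiv_X]
    congr 1
    rw [Finset.sum_eq_single i]
    · simp
    · intro j _ hj
      simp [Pi.single_eq_of_ne hj.symm]
    · simp

theorem exists_dK_eq (s : Fin r → Bool) (q : PrimeSpectrum (MvPolynomial (Fin r) k))
    {b : FunField k r} (hb : b ∈ (chartPoint k s q).toSubring) :
    ∃ c : Fin r → (chartPoint k s q).toSubring,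
      dK k b = ∑ j, (c j : FunField k r) • dK k (chartCoord k s j) := by
  obtain ⟨x, y, hy, rfl⟩ := mem_chartPoint.1 hb
  have hinv : (chartMap k s y)⁻¹ ∈ (chartPoint k s q).toSubring :=
    inv_mem_of_not_vanishes (chartMap_mem_chartPoint s q y) (by rwa [vanishes_chartPoint])
  have hmem := chartMap_mem_chartPoint s q
  refine ⟨fun j => ⟨(chartMap k s y)⁻¹ ^ 2 * (chartMap k s y * chartMap k s (x.pderiv j) -
    chartMap k s x * chartMap k s (y.pderiv j)), mul_mem (pow_mem hinv 2)
      (sub_mem (mul_mem (hmem _) (hmem _)) (mul_mem (hmem _) (hmem _)))⟩, ?_⟩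
  rw [Derivation.leibniz_div, dK_chartMap, dK_chartMap, Finset.smul_sum, Finset.smul_sum,
    ← Finset.sum_sub_distrib, Finset.smul_sum]
  refine Finset.sum_congr rfl fun j _ => ?_
  rw [smul_smul, smul_smul, ← sub_smul, smul_smul]

theorem exists_wedgeD_eq (s : Fin r → Bool) (q : PrimeSpectrum (MvPolynomial (Fin r) k))
    (b : Fin r → (chartPoint k s q).toSubring) :
    ∃ J : Matrix (Fin r) (Fin r) (chartPoint k s q).toSubring,
      (∀ i, dK k (b i : FunField k r) = ∑ j, (J i j : FunField k r) • dK k (chartCoord k s j)) ∧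
      wedgeD k (fun i => (b i : FunField k r)) =
        (J.det : FunField k r) • wedgeD k (chartCoord k s) := by
  choose c hc using fun i => exists_dK_eq s q (b i).2
  refine ⟨Matrix.of c, hc, ?_⟩
  unfold wedgeD
  have h1 : (fun i => KaehlerDifferential.D k (FunField k r) (b i : FunField k r)) =
      fun i => ∑ j, ((Matrix.of c).map (Subring.subtype _)) i j • dK k (chartCoord k s j) := by
    ext1 i
    exact hc i
  rw [h1, AlternatingMap.map_sum_smul]
  congr 1
  exact ((Subring.subtype _).map_det (Matrix.of c)).symm

/-- By the quotient rule, differentials of regular functions are combinations of the `d` of the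
chart coordinates with regular coefficients. Their wedge is therefore a Jacobian determinant times
one generator. -/
theorem mem_regularForms_chartPoint (s : Fin r → Bool)
    (q : PrimeSpectrum (MvPolynomial (Fin r) k)) (ω : ⋀[FunField k r]^r (Ω[FunField k r⁄k])) :
    ω ∈ regularForms k r (chartPoint k s q).toSubring ↔
      ∃ c ∈ (chartPoint k s q).toSubring, ω = c • wedgeD k (chartCoord k s) := by
  constructor
  · intro h
    unfold regularForms at h
    induction h using Submodule.span_induction with
    | mem x hx =>
      obtain ⟨b, rfl⟩ := hx
      obtain ⟨J, -, hJ⟩ := exists_wedgeD_eq s q b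
      exact ⟨_, J.det.2, hJ⟩
    | zero => exact ⟨0, zero_mem _, by rw [zero_smul]⟩
    | add x y _ _ hx hy =>
      obtain ⟨c, hc, rfl⟩ := hx
      obtain ⟨d, hd, rfl⟩ := hy
      exact ⟨c + d, add_mem hc hd, by rw [add_smul]⟩
    | smul a x _ hx =>
      obtain ⟨c, hc, rfl⟩ := hx
      exact ⟨a * c, mul_mem a.2 hc, by rw [mul_smul]; rfl⟩
  · rintro ⟨c, hc, rfl⟩
    have h1 : wedgeD k (chartCoord k s) ∈ regularForms k r (chartPoint k s q).toSubring :=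
      Submodule.subset_span ⟨fun i => ⟨chartCoord k s i, by
        simpa using chartMap_mem_chartPoint s q (MvPolynomial.X i)⟩, rfl⟩
    exact Submodule.smul_mem _ (⟨c, hc⟩ : (chartPoint k s q).toSubring) h1

theorem exists_wedgeD_chartCoord (s : Fin r → Bool) : ∃ c : FunField k r, c ≠ 0 ∧
    wedgeD k (chartCoord k s) = c • wedgeD k (coord k : Fin r → FunField k r) := by
  refine ⟨∏ i, if s i then -(coord k i)⁻¹ ^ 2 else 1, ?_, ?_⟩
  · refine Finset.prod_ne_zero_iff.2 fun i _ => ?_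
    have := coord_ne_zero k i
    split_ifs
    · simpa using this
    · exact one_ne_zero
  · unfold wedgeD
    rw [← AlternatingMap.map_smul_univ]
    congr 1
    ext1 i
    unfold chartCoord
    split_ifs
    · rw [Derivation.leibniz_inv]
    · rw [one_smul]

variable (k r) in
/-- The differentials of the coordinates form a basis. -/
noncomputable def coordBasis : Module.Basis (Fin r) (FunField k r) (Ω[FunField k r⁄k]) :=
  haveI : Algebra.FormallyEtale (MvPolynomial (Fin r) k) (FunField k r) :=
    Algebra.FormallyEtale.of_isLocalization (nonZeroDivisors (MvPolynomial (Fin r) k))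
  ((KaehlerDifferential.mvPolynomialBasis k (Fin r)).baseChange (FunField k r)).map
    (KaehlerDifferential.tensorKaehlerEquivOfFormallyEtale k (MvPolynomial (Fin r) k)
      (FunField k r))

theorem coordBasis_apply (i : Fin r) : coordBasis k r i = dK k (coord k i) := by
  unfold coordBasis
  rw [Module.Basis.map_apply, Module.Basis.baseChange_apply,
    KaehlerDifferential.mvPolynomialBasis_apply,
    KaehlerDifferential.tensorKaehlerEquivOfFormallyEtale_apply,
    KaehlerDifferential.mapBaseChange_tmul, one_smul, KaehlerDifferential.map_D]
  rfl

theorem wedgeD_coord_ne_zero : wedgeD k (coord k : Fin r → FunField k r) ≠ 0 := by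
  intro h
  have h1 := congrArg (exteriorPower.alternatingMapLinearEquiv (coordBasis k r).det) h
  unfold wedgeD at h1
  rw [exteriorPower.alternatingMapLinearEquiv_apply_ιMulti, map_zero] at h1
  have h2 : (fun i => KaehlerDifferential.D k (FunField k r) (coord k i)) = coordBasis k r := by
    ext1 i
    rw [coordBasis_apply]
  rw [h2, Module.Basis.det_self] at h1
  exact one_ne_zero h1

theorem exists_eq_smul_wedgeD (ω : ⋀[FunField k r]^r (Ω[FunField k r⁄k])) :
    ∃ g : FunField k r, ω = g • wedgeD k (coord k : Fin r → FunField k r) := by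
  have h : ω ∈ (⊤ : Submodule (FunField k r) (⋀[FunField k r]^r (Ω[FunField k r⁄k]))) := trivial
  rw [← exteriorPower.ιMulti_span] at h
  induction h using Submodule.span_induction with
  | mem x hx =>
    obtain ⟨v, rfl⟩ := hx
    refine ⟨(Matrix.of fun i j => (coordBasis k r).repr (v i) j).det, ?_⟩
    unfold wedgeD
    rw [← AlternatingMap.map_sum_smul]
    congr 1
    ext1 i
    conv_lhs => rw [← (coordBasis k r).sum_repr (v i)]
    simp_rw [coordBasis_apply]
    rfl
  | zero => exact ⟨0, by rw [zero_smul]⟩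
  | add x y _ _ hx hy =>
    obtain ⟨c, rfl⟩ := hx
    obtain ⟨d, rfl⟩ := hy
    exact ⟨c + d, by rw [add_smul]⟩
  | smul a x _ hx =>
    obtain ⟨c, rfl⟩ := hx
    exact ⟨a * c, by rw [mul_smul]⟩

theorem smul_wedgeD_injective {f g : FunField k r}
    (h : f • wedgeD k (coord k : Fin r → FunField k r) = g • wedgeD k (coord k)) : f = g :=
  smul_left_injective _ wedgeD_coord_ne_zero h

/-- Here `κ` is the factor between `dx_1 ∧ ⋯ ∧ dx_r` and the generator of the regular forms in a
chart that meets `Y`. -/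
theorem exists_regularForms_iff (Y : PrimeDivisor (P1Pow k r)) :
    ∃ κ : FunField k r, κ ≠ 0 ∧ (Y.IsAffine → κ = 1) ∧ ∀ g : FunField k r,
      g • wedgeD k (coord k) ∈ regularForms k r Y.ring.toSubring ↔ g / κ ∈ Y.ring := by
  have key : ∀ (s : Fin r → Bool) (κ : FunField k r), κ ≠ 0 →
      wedgeD k (chartCoord k s) = κ • wedgeD k (coord k) →
      (∃ q, Y.ring.toLocalSubring = chartPoint k s q) → ∀ g : FunField k r,
      g • wedgeD k (coord k) ∈ regularForms k r Y.ring.toSubring ↔ g / κ ∈ Y.ring := by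
    rintro s κ hκ h ⟨q, hq⟩ g
    change _ ∈ regularForms k r Y.ring.toLocalSubring.toSubring ↔
      _ ∈ Y.ring.toLocalSubring.toSubring
    rw [hq, mem_regularForms_chartPoint]
    constructor
    · rintro ⟨c, hc, h1⟩
      rw [h, smul_smul] at h1
      rwa [smul_wedgeD_injective h1, mul_div_cancel_right₀ _ hκ]
    · intro hg
      exact ⟨_, hg, by rw [h, smul_smul, div_mul_cancel₀ _ hκ]⟩
  by_cases hY : Y.IsAffine
  · refine ⟨1, one_ne_zero, fun _ => rfl, key (fun _ => false) 1 one_ne_zero ?_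
      (exists_chartPoint_of_coord_mem Y.mem _ hY)⟩
    rw [one_smul]
    rfl
  · obtain ⟨s, hs⟩ := exists_chartPoint Y.mem
    obtain ⟨κ, hκ, h⟩ := exists_wedgeD_chartCoord (k := k) s
    exact ⟨κ, hκ, fun h => absurd h hY, key s κ hκ h hs⟩

/-- After subtracting the orders of the factors `κ`, the condition on a form becomes a Riemann-Roch
condition on its coefficient. These corrections vanish on affine divisors, so they only shift the
degree bounds. -/
theorem exists_formSpace_iff {W : PrimeDivisor (P1Pow k r) → ℤ} {H : FunField k r} (hH : H ≠ 0)
    (hW : ∀ Y : PrimeDivisor (P1Pow k r), Y.IsAffine → Y.ord H = W Y) :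
    ∃ n : Fin r → ℤ, ∀ g : FunField k r, g • wedgeD k (coord k) ∈ formSpace (X := P1Pow k r) k r W ↔
      ∃ p ∈ polySpace k n, g = affineMap p / H := by
  choose κ hκ0 hκ1 hκ using exists_regularForms_iff (k := k) (r := r)
  have h1 : ∀ g : FunField k r, g • wedgeD k (coord k) ∈ formSpace (X := P1Pow k r) k r W ↔
      g ∈ rrSpace fun Y : PrimeDivisor (P1Pow k r) => W Y - Y.ord (κ Y) := by
    intro g
    constructor
    · intro h
      by_cases hg : g = 0
      · exact Or.inl hg
      right
      intro Y
      obtain ⟨t, ht0, ht, hmem⟩ := h Y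
      rw [smul_smul, hκ, Y.mem_ring_iff (div_ne_zero (mul_ne_zero ht0 hg) (hκ0 Y)),
        Y.ord_div (mul_ne_zero ht0 hg) (hκ0 Y), Y.ord_mul ht0 hg, ht] at hmem
      change 0 ≤ Y.ord g + (W Y - Y.ord (κ Y))
      omega
    · rintro h Y
      obtain ⟨t, ht0, ht⟩ := Y.exists_ord_eq (W Y)
      refine ⟨t, ht0, ht, ?_⟩
      rcases h with rfl | h
      · rw [zero_smul, smul_zero]
        exact zero_mem _
      · by_cases hg : g = 0
        · rw [hg, zero_smul, smul_zero]
          exact zero_mem _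
        have := h Y
        dsimp only at this
        rw [smul_smul, hκ, Y.mem_ring_iff (div_ne_zero (mul_ne_zero ht0 hg) (hκ0 Y)),
          Y.ord_div (mul_ne_zero ht0 hg) (hκ0 Y), Y.ord_mul ht0 hg, ht]
        omega
  refine ⟨_, fun g => (h1 g).trans (mem_rrSpace_iff hH fun Y hY => ?_)⟩
  rw [hκ1 Y hY, Y.ord_one, sub_zero, hW Y hY]

theorem exists_dK_eq_affinePoint {α : Fin r → k} (b : (affinePoint k α).toSubring) :
    ∃ c : Fin r → (affinePoint k α).toSubring,
      dK k (b : FunField k r) = ∑ j, (c j : FunField k r) • dK k (coord k j) :=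
  exists_dK_eq (fun _ => false) _ b.2

theorem exists_wedgeD_eq_affinePoint {α : Fin r → k} (b : Fin r → (affinePoint k α).toSubring) :
    ∃ J : Matrix (Fin r) (Fin r) (affinePoint k α).toSubring,
      (∀ i, dK k (b i : FunField k r) = ∑ j, (J i j : FunField k r) • dK k (coord k j)) ∧
      wedgeD k (fun i => (b i : FunField k r)) =
        (J.det : FunField k r) • wedgeD k (coord k) :=
  exists_wedgeD_eq (fun _ => false) _ b

/-- The Jacobian of any generators of the maximal ideal is a unit. Write the shifted coordinates as
`B x` and differentiate: the identity matrix equals `B * J` plus terms with a factor `x j`, so `J`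
is invertible over the residue field. -/
theorem exists_wedgeD_localParameters {α : Fin r → k} (x : Fin r → (affinePoint k α).toSubring)
    (hx : Ideal.span (Set.range x) = IsLocalRing.maximalIdeal (affinePoint k α).toSubring) :
    ∃ u : FunField k r, u ≠ 0 ∧ u ∈ (affinePoint k α).toSubring ∧
      u⁻¹ ∈ (affinePoint k α).toSubring ∧
      wedgeD k (fun i => (x i : FunField k r)) = u • wedgeD k (coord k) := by
  classical
  obtain ⟨J, hJ, hJw⟩ := exists_wedgeD_eq_affinePoint x
  have hy : ∀ i, ∃ B : Fin r → (affinePoint k α).toSubring,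
      coord k i - algebraMap k _ (α i) = ∑ j, (B j : FunField k r) * (x j : FunField k r) := by
    intro i
    have hv : Vanishes (affinePoint k α) (affineMap (MvPolynomial.X i - MvPolynomial.C (α i))) := by
      rw [vanishes_affineMap]
      simp
    obtain ⟨z, hz, e⟩ := hv
    rw [← hx, Ideal.mem_span_range_iff_exists_fun] at hz
    obtain ⟨B, hB⟩ := hz
    refine ⟨B, ?_⟩
    rw [map_sub, ← algebraMap_eq_affineMap_C] at e
    change coord k i - _ = _ at e
    rw [e, ← hB]
    simp
  choose B hB using hy
  choose N hN using fun i j => exists_dK_eq_affinePoint (B i j)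
  have hxm : ∀ j, x j ∈ IsLocalRing.maximalIdeal (affinePoint k α).toSubring := fun j => hx ▸ Ideal.subset_span ⟨j, rfl⟩
  have hmat : ∀ i l, (if i = l then 1 else 0 : (affinePoint k α).toSubring) = ∑ j, B i j * J j l + ∑ j, x j * N i j l := by
    intro i l
    have h1 : dK k (coord k i) = ∑ l, (∑ j, (B i j : FunField k r) * (J j l : FunField k r) +
        ∑ j, (x j : FunField k r) * (N i j l : FunField k r)) • dK k (coord k l) := by
      have h2 : dK k (coord k i) = dK k (coord k i - algebraMap k _ (α i)) := by
        rw [map_sub, Derivation.map_algebraMap, sub_zero]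
      rw [h2, hB, map_sum]
      simp_rw [add_smul, Finset.sum_add_distrib, Finset.sum_smul]
      rw [Finset.sum_comm, Finset.sum_comm (f := fun (a b : Fin r) =>
        ((x b : FunField k r) * (N i b a : FunField k r)) • dK k (coord k a)),
        ← Finset.sum_add_distrib]
      refine Finset.sum_congr rfl fun j _ => ?_
      rw [Derivation.leibniz, hJ, hN, Finset.smul_sum, Finset.smul_sum]
      simp_rw [smul_smul]
    have h3 := congrArg (fun ω => (coordBasis k r).repr ω l) h1
    simp only [← coordBasis_apply] at h3
    rw [Module.Basis.repr_self, (coordBasis k r).repr_sum_self] at h3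
    apply Subtype.ext
    rw [Finsupp.single_apply] at h3
    simp only [Subring.coe_add, AddSubmonoidClass.coe_finsetSum, Subring.coe_mul]
    rw [← h3]
    split_ifs <;> rfl
  have hprod : (Matrix.of B).map (IsLocalRing.residue (affinePoint k α).toSubring) * J.map (IsLocalRing.residue (affinePoint k α).toSubring) = 1 := by
    ext i l
    have h1 := congrArg (IsLocalRing.residue (affinePoint k α).toSubring) (hmat i l)
    rw [map_add, map_sum, map_sum] at h1
    have h2 : ∑ j, IsLocalRing.residue (affinePoint k α).toSubring (x j * N i j l) = 0 := by
      refine Finset.sum_eq_zero fun j _ => ?_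
      rw [IsLocalRing.residue_eq_zero_iff]
      exact Ideal.mul_mem_right _ _ (hxm j)
    rw [h2, add_zero] at h1
    rw [Matrix.mul_apply, Matrix.one_apply]
    simp only [Matrix.map_apply, Matrix.of_apply]
    simp only [map_mul] at h1
    rw [← h1]
    split_ifs <;> simp
  have hdet : IsLocalRing.residue (affinePoint k α).toSubring J.det ≠ 0 := by
    rw [RingHom.map_det]
    intro h0
    have := congrArg Matrix.det hprod
    rw [Matrix.det_mul, Matrix.det_one] at this
    change _ * (((IsLocalRing.residue (affinePoint k α).toSubring).mapMatrix J).det) = 1 at this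
    rw [h0, mul_zero] at this
    exact zero_ne_one this
  have hnv : ¬ Vanishes (affinePoint k α) (J.det : FunField k r) := by
    intro hv
    exact hdet ((IsLocalRing.residue_eq_zero_iff _).2 (vanishes_coe.1 hv))
  exact ⟨J.det, ne_zero_of_not_vanishes hnv, J.det.2, inv_mem_of_not_vanishes J.det.2 hnv, hJw⟩

end Forms

/-! ### Power series expansions at a rational point: existence and uniqueness. -/

section Expansions

variable {k : Type*} [Field k] {r : ℕ}

/-- A polynomial with nonzero constant term is a unit modulo each power of the ideal of the origin:
`c - s` lies in the ideal, and `s` divides `c ^ N - (c - s) ^ N`. -/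
theorem mem_pow_idealOfVars_of_mul_mem {s p : MvPolynomial (Fin r) k} {N : ℕ}
    (hs : MvPolynomial.constantCoeff s ≠ 0) (h : s * p ∈ MvPolynomial.idealOfVars (Fin r) k ^ N) :
    p ∈ MvPolynomial.idealOfVars (Fin r) k ^ N := by
  set c := MvPolynomial.constantCoeff s
  have ht : MvPolynomial.C c - s ∈ MvPolynomial.idealOfVars (Fin r) k := by
    rw [← pow_one (MvPolynomial.idealOfVars (Fin r) k), MvPolynomial.mem_pow_idealOfVars_iff']
    intro e he
    have he0 : e = 0 := by
      rw [← Finsupp.degree_eq_zero_iff]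
      omega
    rw [he0, MvPolynomial.coeff_sub, MvPolynomial.coeff_C, if_pos rfl]
    exact sub_self _
  obtain ⟨d, hd⟩ := sub_dvd_pow_sub_pow (MvPolynomial.C c) (MvPolynomial.C c - s) N
  rw [sub_sub_cancel] at hd
  have h1 : MvPolynomial.C c ^ N * p ∈ MvPolynomial.idealOfVars (Fin r) k ^ N := by
    have e : MvPolynomial.C c ^ N * p = d * (s * p) + p * (MvPolynomial.C c - s) ^ N := by
      linear_combination p * hd
    rw [e]
    exact add_mem (Ideal.mul_mem_left _ _ h) (Ideal.mul_mem_left _ _ (Ideal.pow_mem_pow ht N))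
  have e : p = MvPolynomial.C (c⁻¹ ^ N) * (MvPolynomial.C c ^ N * p) := by
    rw [← mul_assoc, ← map_pow, ← map_mul, ← mul_pow, inv_mul_cancel₀ hs]
    simp
  rw [e]
  exact Ideal.mul_mem_left _ _ h1

theorem exists_mul_eq_of_mem_pow_maximalIdeal {α : Fin r → k} {N : ℕ}
    {z : (affinePoint k α).toSubring}
    (hz : z ∈ IsLocalRing.maximalIdeal (affinePoint k α).toSubring ^ N) :
    ∃ s a : MvPolynomial (Fin r) k, MvPolynomial.eval α s ≠ 0 ∧
      a ∈ RingHom.ker (MvPolynomial.eval α) ^ N ∧ affineMap s * (z : FunField k r) = affineMap a := by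
  induction N generalizing z with
  | zero =>
    obtain ⟨a, b, hb, e⟩ := mem_affinePoint.1 z.2
    have hb0 : affineMap b ≠ 0 := affineMap_ne_zero (by rintro rfl; simp at hb)
    exact ⟨b, a, hb, by simp, by rw [e, mul_div_cancel₀ _ hb0]⟩
  | succ N ih =>
    rw [pow_succ] at hz
    induction hz using Submodule.mul_induction_on' with
    | mem_mul_mem z hz w hw =>
      obtain ⟨s, a, hs, ha, e⟩ := ih hz
      obtain ⟨c, b, hb, e'⟩ := mem_affinePoint.1 w.2
      have hb0 : affineMap b ≠ 0 := affineMap_ne_zero (by rintro rfl; simp at hb)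
      have hc : MvPolynomial.eval α c = 0 := by
        rw [← vanishes_affineMap, ← div_mul_cancel₀ (affineMap c) hb0, ← e']
        exact (vanishes_coe.2 hw).mul_right (affineMap_mem_affinePoint α b)
      refine ⟨s * b, a * c, by simpa using ⟨hs, hb⟩, ?_, ?_⟩
      · rw [pow_succ]
        exact Ideal.mul_mem_mul ha (RingHom.mem_ker.2 hc)
      · rw [Subring.coe_mul, map_mul, map_mul, ← e, e']
        field_simp
    | add x _ y _ hx hy =>
      obtain ⟨s, a, hs, ha, e⟩ := hx
      obtain ⟨t, b, ht, hb, e'⟩ := hy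
      refine ⟨s * t, t * a + s * b, by simpa using ⟨hs, ht⟩,
        add_mem (Ideal.mul_mem_left _ _ ha) (Ideal.mul_mem_left _ _ hb), ?_⟩
      rw [Subring.coe_add, map_add, map_mul, map_mul, map_mul, ← e, ← e']
      ring

variable (k) in
/-- The scalars as elements of the local ring at an affine point. -/
noncomputable def constHom (α : Fin r → k) : k →+* (affinePoint k α).toSubring :=
  (algebraMap k (FunField k r)).codRestrict _ (algebraMap_mem_affinePoint α)

/-- Substitution of elements of the local ring at an affine point into polynomials. -/
noncomputable def localEval {α : Fin r → k} (x : Fin r → (affinePoint k α).toSubring) :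
    MvPolynomial (Fin r) k →+* (affinePoint k α).toSubring :=
  MvPolynomial.eval₂Hom (constHom k α) x

theorem coe_localEval {α : Fin r → k} (x : Fin r → (affinePoint k α).toSubring)
    (p : MvPolynomial (Fin r) k) : (localEval x p : FunField k r) =
      MvPolynomial.aeval (fun i => (x i : FunField k r)) p := by
  have h := MvPolynomial.eval₂_comp_left (Subring.subtype (affinePoint k α).toSubring)
    (constHom k α) x p
  exact h

@[simp]
theorem localEval_X {α : Fin r → k} (x : Fin r → (affinePoint k α).toSubring) (i : Fin r) :
    localEval x (MvPolynomial.X i) = x i := by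
  simp [localEval]

@[simp]
theorem localEval_C {α : Fin r → k} (x : Fin r → (affinePoint k α).toSubring) (c : k) :
    localEval x (MvPolynomial.C c) = constHom k α c := by
  simp [localEval]

theorem exists_sub_constHom_mem {α : Fin r → k} (z : (affinePoint k α).toSubring) :
    ∃ c, z - constHom k α c ∈ IsLocalRing.maximalIdeal (affinePoint k α).toSubring := by
  obtain ⟨c, hc⟩ := exists_hasValue z.2
  exact ⟨c, (vanishes_coe (z := z - constHom k α c)).1 hc⟩

theorem localEval_mem_pow {α : Fin r → k} {x : Fin r → (affinePoint k α).toSubring}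
    (hx : ∀ i, x i ∈ IsLocalRing.maximalIdeal (affinePoint k α).toSubring) {N : ℕ}
    {p : MvPolynomial (Fin r) k} (hp : p ∈ MvPolynomial.idealOfVars (Fin r) k ^ N) :
    localEval x p ∈ IsLocalRing.maximalIdeal (affinePoint k α).toSubring ^ N := by
  have h1 : (MvPolynomial.idealOfVars (Fin r) k).map (localEval x) ≤
      IsLocalRing.maximalIdeal (affinePoint k α).toSubring := by
    rw [MvPolynomial.idealOfVars, Ideal.map_span, Ideal.span_le]
    rintro _ ⟨_, ⟨i, rfl⟩, rfl⟩
    rw [localEval_X]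
    exact hx i
  have h2 := Ideal.mem_map_of_mem (localEval x) hp
  rw [Ideal.map_pow] at h2
  exact Ideal.pow_right_mono h1 N h2

/-- The `N`-th power of the maximal ideal is generated by values of polynomials of order at least
`N`, and coefficients may be replaced by constants modulo the maximal ideal because the point is
rational. -/
theorem exists_localEval_sub_mem_pow_succ {α : Fin r → k}
    {x : Fin r → (affinePoint k α).toSubring}
    (hx : Ideal.span (Set.range x) = IsLocalRing.maximalIdeal (affinePoint k α).toSubring) (N : ℕ)
    {z : (affinePoint k α).toSubring}
    (hz : z ∈ IsLocalRing.maximalIdeal (affinePoint k α).toSubring ^ N) :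
    ∃ p ∈ MvPolynomial.idealOfVars (Fin r) k ^ N,
      z - localEval x p ∈ IsLocalRing.maximalIdeal (affinePoint k α).toSubring ^ (N + 1) := by
  have hxm : ∀ i, x i ∈ IsLocalRing.maximalIdeal (affinePoint k α).toSubring :=
    fun i => hx ▸ Ideal.subset_span ⟨i, rfl⟩
  have hmap : IsLocalRing.maximalIdeal (affinePoint k α).toSubring ^ N =
      Ideal.span (localEval x '' (MvPolynomial.idealOfVars (Fin r) k ^ N : Ideal _)) := by
    change _ = Ideal.map (localEval x) _
    rw [Ideal.map_pow, MvPolynomial.idealOfVars, Ideal.map_span, ← Set.range_comp, ← hx]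
    congr 3
    ext1 i
    simp
  rw [hmap] at hz
  induction hz using Submodule.span_induction with
  | mem z hz =>
    obtain ⟨p, hp, rfl⟩ := hz
    exact ⟨p, hp, by simp⟩
  | zero => exact ⟨0, zero_mem _, by simp⟩
  | add z w _ _ hz hw =>
    obtain ⟨p, hp, h⟩ := hz
    obtain ⟨q, hq, h'⟩ := hw
    refine ⟨p + q, add_mem hp hq, ?_⟩
    rw [map_add, add_sub_add_comm]
    exact add_mem h h'
  | smul b z _ hz =>
    obtain ⟨p, hp, h⟩ := hz
    obtain ⟨c, hc⟩ := exists_sub_constHom_mem b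
    refine ⟨MvPolynomial.C c * p, Ideal.mul_mem_left _ _ hp, ?_⟩
    have e : b • z - localEval x (MvPolynomial.C c * p) =
        b * (z - localEval x p) + localEval x p * (b - constHom k α c) := by
      rw [map_mul, localEval_C, smul_eq_mul]
      ring
    rw [e]
    refine add_mem (Ideal.mul_mem_left _ _ h) ?_
    rw [pow_succ]
    exact Ideal.mul_mem_mul (localEval_mem_pow hxm hp) hc

theorem exists_compatible_approximations {α : Fin r → k} {x : Fin r → (affinePoint k α).toSubring}
    (hx : Ideal.span (Set.range x) = IsLocalRing.maximalIdeal (affinePoint k α).toSubring)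
    (z : (affinePoint k α).toSubring) :
    ∃ p : ℕ → MvPolynomial (Fin r) k,
      (∀ n, z - localEval x (p n) ∈ IsLocalRing.maximalIdeal (affinePoint k α).toSubring ^ n) ∧
      ∀ n, p (n + 1) - p n ∈ MvPolynomial.idealOfVars (Fin r) k ^ n := by
  have h := fun (n : ℕ) (q : MvPolynomial (Fin r) k) (hq : z - localEval x q ∈
    IsLocalRing.maximalIdeal (affinePoint k α).toSubring ^ n) =>
    exists_localEval_sub_mem_pow_succ hx n hq
  choose f hf hf' using h
  let seq : (n : ℕ) → {q : MvPolynomial (Fin r) k // z - localEval x q ∈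
      IsLocalRing.maximalIdeal (affinePoint k α).toSubring ^ n} := fun n =>
    Nat.rec ⟨0, by simp⟩ (fun n q => ⟨q.1 + f n q.1 q.2, by
      have := hf' n q.1 q.2
      rwa [map_add, ← sub_sub]⟩) n
  refine ⟨fun n => (seq n).1, fun n => (seq n).2, fun n => ?_⟩
  have : (seq (n + 1)).1 = (seq n).1 + f n (seq n).1 (seq n).2 := rfl
  dsimp only
  rw [this, add_sub_cancel_left]
  exact hf _ _ _

theorem exists_localEval_sub_mem_pow {α : Fin r → k} {x : Fin r → (affinePoint k α).toSubring}
    (hx : Ideal.span (Set.range x) = IsLocalRing.maximalIdeal (affinePoint k α).toSubring) (N : ℕ)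
    (z : (affinePoint k α).toSubring) : ∃ p,
      z - localEval x p ∈ IsLocalRing.maximalIdeal (affinePoint k α).toSubring ^ N := by
  obtain ⟨p, hp, -⟩ := exists_compatible_approximations hx z
  exact ⟨p N, hp N⟩

theorem hasExpansion_iff {α : Fin r → k} {x : Fin r → (affinePoint k α).toSubring}
    {h : (affinePoint k α).toSubring} {S : MvPowerSeries (Fin r) k} :
    HasExpansion k x h S ↔ ∀ (n : ℕ) (p : MvPolynomial (Fin r) k),
      (∀ I : Fin r →₀ ℕ, I.degree < n → p.coeff I = MvPowerSeries.coeff I S) →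
      h - localEval x p ∈ IsLocalRing.maximalIdeal (affinePoint k α).toSubring ^ n := by
  refine forall_congr' fun n => forall_congr' fun p => imp_congr_right fun _ => ?_
  rw [← coe_localEval]
  constructor
  · rintro ⟨z, hz, e⟩
    have : h - localEval x p = z := Subtype.ext e
    rwa [this]
  · exact fun hz => ⟨_, hz, rfl⟩

/-- Successive approximations differ only in degrees at least `n`, so the coefficient of each
monomial `I` is stable from the stage `I.degree + 1` on. -/
theorem exists_hasExpansion {α : Fin r → k} {x : Fin r → (affinePoint k α).toSubring}
    (hx : Ideal.span (Set.range x) = IsLocalRing.maximalIdeal (affinePoint k α).toSubring)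
    (h : (affinePoint k α).toSubring) : ∃ S, HasExpansion k x h S := by
  obtain ⟨p, hp, hpp⟩ := exists_compatible_approximations hx h
  have hcoeff : ∀ (I : Fin r →₀ ℕ) (n : ℕ), I.degree < n →
      (p n).coeff I = (p (I.degree + 1)).coeff I := by
    intro I n hn
    induction n, hn using Nat.le_induction with
    | base => rfl
    | succ n hn ih =>
      have h1 := (MvPolynomial.mem_pow_idealOfVars_iff' _ _).1 (hpp n) I hn
      rw [MvPolynomial.coeff_sub, sub_eq_zero] at h1
      rw [h1, ih]
  let S : MvPowerSeries (Fin r) k := fun I => (p (I.degree + 1)).coeff I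
  have hS : ∀ I, MvPowerSeries.coeff I S = (p (I.degree + 1)).coeff I := fun I => rfl
  refine ⟨S, hasExpansion_iff.2 fun n q hq => ?_⟩
  have h1 : p n - q ∈ MvPolynomial.idealOfVars (Fin r) k ^ n := by
    rw [MvPolynomial.mem_pow_idealOfVars_iff']
    intro I hI
    rw [MvPolynomial.coeff_sub, hq I hI, hS, hcoeff I n hI, sub_self]
  have h2 := localEval_mem_pow (fun i => hx ▸ Ideal.subset_span ⟨i, rfl⟩) h1 (x := x)
  have h3 := add_mem (hp n) h2
  rwa [map_sub, sub_add_sub_cancel] at h3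

/-- The shifted coordinates at an affine point. -/
noncomputable def shiftedCoord (α : Fin r → k) (i : Fin r) : (affinePoint k α).toSubring :=
  ⟨affineMap (MvPolynomial.X i - MvPolynomial.C (α i)), affineMap_mem_affinePoint α _⟩

theorem shiftedCoord_mem (α : Fin r → k) (i : Fin r) :
    shiftedCoord α i ∈ IsLocalRing.maximalIdeal (affinePoint k α).toSubring := by
  rw [← vanishes_coe]
  exact vanishes_affineMap.2 (by simp)

/-- Translate the point to the origin by `σ`. Denominators become polynomials with nonzero constant
term, which can be cancelled. -/
theorem mem_pow_idealOfVars_of_localEval_shiftedCoord_mem {α : Fin r → k} {N : ℕ}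
    {p : MvPolynomial (Fin r) k} (hp : localEval (shiftedCoord α) p ∈
      IsLocalRing.maximalIdeal (affinePoint k α).toSubring ^ N) :
    p ∈ MvPolynomial.idealOfVars (Fin r) k ^ N := by
  obtain ⟨s, a, hs, ha, e⟩ := exists_mul_eq_of_mem_pow_maximalIdeal hp
  let τ : MvPolynomial (Fin r) k →ₐ[k] MvPolynomial (Fin r) k :=
    MvPolynomial.aeval fun i => MvPolynomial.X i - MvPolynomial.C (α i)
  let σ : MvPolynomial (Fin r) k →ₐ[k] MvPolynomial (Fin r) k :=
    MvPolynomial.aeval fun i => MvPolynomial.X i + MvPolynomial.C (α i)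
  have hτ : (localEval (shiftedCoord α) p : FunField k r) = affineMap (τ p) := by
    rw [coe_localEval]
    have : MvPolynomial.aeval (fun i => (shiftedCoord α i : FunField k r)) =
        (IsScalarTower.toAlgHom k (MvPolynomial (Fin r) k) (FunField k r)).comp τ := by
      ext i
      simp [τ, shiftedCoord]
    rw [this]
    rfl
  rw [hτ, ← map_mul] at e
  have e' := congrArg σ (IsFractionRing.injective (MvPolynomial (Fin r) k) (FunField k r) e)
  have hστ : σ (τ p) = p := by
    have : σ.comp τ = AlgHom.id k _ := by
      ext1 i
      simp [σ, τ, ← MvPolynomial.algebraMap_eq]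
    exact DFunLike.congr_fun this p
  rw [map_mul, hστ] at e'
  have hconst : ∀ q, MvPolynomial.constantCoeff (σ q) = MvPolynomial.eval α q := by
    have : (MvPolynomial.constantCoeff).comp (σ : _ →+* MvPolynomial (Fin r) k) =
        MvPolynomial.eval α := by
      apply MvPolynomial.ringHom_ext <;> intro i <;> simp [σ, ← MvPolynomial.algebraMap_eq]
    exact fun q => DFunLike.congr_fun this q
  refine mem_pow_idealOfVars_of_mul_mem (s := σ s) (by rwa [hconst]) ?_
  rw [e']
  have h1 : (RingHom.ker (MvPolynomial.eval α)).map (σ : _ →+* MvPolynomial (Fin r) k) ≤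
      MvPolynomial.idealOfVars (Fin r) k := by
    rw [Ideal.map_le_iff_le_comap]
    intro q hq
    rw [Ideal.mem_comap, ← pow_one (MvPolynomial.idealOfVars (Fin r) k),
      MvPolynomial.mem_pow_idealOfVars_iff']
    intro I hI
    have hI0 : I = 0 := by
      rw [← Finsupp.degree_eq_zero_iff]
      omega
    rw [hI0]
    exact (hconst q).trans hq
  have h2 := Ideal.mem_map_of_mem (σ : _ →+* MvPolynomial (Fin r) k) ha
  rw [Ideal.map_pow] at h2
  exact Ideal.pow_right_mono h1 N h2

theorem finite_quotient_pow_idealOfVars [Finite k] (N : ℕ) :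
    Finite (MvPolynomial (Fin r) k ⧸ MvPolynomial.idealOfVars (Fin r) k ^ N) := by
  have : Finite (MvPolynomial (Fin r) k ⧸ MvPolynomial.idealOfVars (Fin r) k) := by
    refine Finite.of_surjective (fun c : k => Ideal.Quotient.mk _ (MvPolynomial.C c)) fun q => ?_
    obtain ⟨p, rfl⟩ := Ideal.Quotient.mk_surjective q
    refine ⟨MvPolynomial.constantCoeff p, ?_⟩
    rw [Ideal.Quotient.eq, ← pow_one (MvPolynomial.idealOfVars (Fin r) k),
      MvPolynomial.mem_pow_idealOfVars_iff']
    intro I hI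
    have hI0 : I = 0 := by
      rw [← Finsupp.degree_eq_zero_iff]
      omega
    rw [hI0, MvPolynomial.coeff_sub, MvPolynomial.coeff_C, if_pos rfl]
    exact sub_self _
  exact Ideal.finite_quotient_pow (MvPolynomial.idealOfVars_fg _ _) N

/-- This gives uniqueness of expansions in arbitrary parameters by counting. Over a finite field
both quotients by `N`-th powers are finite. Substituting the shifted coordinates is injective, so
the target is at least as large as the source; substituting `x` is surjective, hence bijective. -/
theorem mem_pow_idealOfVars_of_localEval_mem [Finite k] {α : Fin r → k}
    {x : Fin r → (affinePoint k α).toSubring}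
    (hx : Ideal.span (Set.range x) = IsLocalRing.maximalIdeal (affinePoint k α).toSubring) {N : ℕ}
    {p : MvPolynomial (Fin r) k}
    (hp : localEval x p ∈ IsLocalRing.maximalIdeal (affinePoint k α).toSubring ^ N) :
    p ∈ MvPolynomial.idealOfVars (Fin r) k ^ N := by
  have hfin := finite_quotient_pow_idealOfVars (k := k) (r := r) N
  let ψ : ∀ y : Fin r → (affinePoint k α).toSubring,
      (∀ i, y i ∈ IsLocalRing.maximalIdeal (affinePoint k α).toSubring) →
      MvPolynomial (Fin r) k ⧸ MvPolynomial.idealOfVars (Fin r) k ^ N →+*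
      (affinePoint k α).toSubring ⧸ IsLocalRing.maximalIdeal (affinePoint k α).toSubring ^ N :=
    fun y hy => Ideal.quotientMap _ (localEval y) fun _ hq => localEval_mem_pow hy hq
  have hψ : ∀ y hy q, ψ y hy (Ideal.Quotient.mk _ q) = Ideal.Quotient.mk _ (localEval y q) :=
    fun _ _ _ => rfl
  have hxm : ∀ i, x i ∈ IsLocalRing.maximalIdeal (affinePoint k α).toSubring :=
    fun i => hx ▸ Ideal.subset_span ⟨i, rfl⟩
  have hsurj : Function.Surjective (ψ x hxm) := by
    intro z
    obtain ⟨z, rfl⟩ := Ideal.Quotient.mk_surjective z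
    obtain ⟨q, hq⟩ := exists_localEval_sub_mem_pow hx N z
    refine ⟨Ideal.Quotient.mk _ q, ?_⟩
    rw [hψ x hxm, eq_comm, Ideal.Quotient.eq]
    exact hq
  have hinj : Function.Injective (ψ (shiftedCoord α) (shiftedCoord_mem α)) := by
    rw [injective_iff_map_eq_zero]
    intro q hq
    obtain ⟨q, rfl⟩ := Ideal.Quotient.mk_surjective q
    rw [hψ _ (shiftedCoord_mem α), Ideal.Quotient.eq_zero_iff_mem] at hq
    rw [Ideal.Quotient.eq_zero_iff_mem]
    exact mem_pow_idealOfVars_of_localEval_shiftedCoord_mem hq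
  have hfin' := Finite.of_surjective _ hsurj
  have hbij := hsurj.bijective_of_nat_card_le (Nat.card_le_card_of_injective _ hinj)
  have h0 : ψ x hxm (Ideal.Quotient.mk _ p) = ψ x hxm 0 := by
    rw [map_zero, hψ x hxm, Ideal.Quotient.eq_zero_iff_mem]
    exact hp
  exact Ideal.Quotient.eq_zero_iff_mem.1 (hbij.1 h0)

/-- Modulo a high power of the maximal ideal, `g` is `c` times the monomial with all exponents `a -
1` plus multiples of the `x i ^ a`, and these multiples do not contain that monomial. Uniqueness of
expansions does the rest. -/
theorem coeff_expansion_eq [Finite k] {α : Fin r → k} {x : Fin r → (affinePoint k α).toSubring}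
    (hx : Ideal.span (Set.range x) = IsLocalRing.maximalIdeal (affinePoint k α).toSubring)
    {a : ℕ} (ha : 0 < a) {g : (affinePoint k α).toSubring} {c : k}
    (hg : g - constHom k α c * ∏ j, x j ^ (a - 1) ∈ Ideal.span (Set.range fun i => x i ^ a))
    {S : MvPowerSeries (Fin r) k} (hS : HasExpansion k x g S) :
    MvPowerSeries.coeff (Finsupp.equivFunOnFinite.symm fun _ => a - 1) S = c := by
  set e : Fin r →₀ ℕ := Finsupp.equivFunOnFinite.symm fun _ => a - 1
  -- The smallest precision at which the coefficient of `e` is determined.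
  set N := e.degree + 1
  rw [Ideal.mem_span_range_iff_exists_fun] at hg
  obtain ⟨z, hz⟩ := hg
  choose q hq using fun i => exists_localEval_sub_mem_pow hx N (z i)
  have h1 := hasExpansion_iff.1 hS N (S.truncTotal N) fun I hI =>
    MvPowerSeries.coeff_truncTotal _ hI
  have he : MvPolynomial.monomial e c = MvPolynomial.C c * ∏ j, MvPolynomial.X j ^ (a - 1) := by
    rw [MvPolynomial.monomial_eq, Finsupp.prod_fintype _ _ (by simp)]
    rfl
  have h2 : localEval x (S.truncTotal N - MvPolynomial.monomial e c -
      ∑ i, q i * MvPolynomial.X i ^ a) ∈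
      IsLocalRing.maximalIdeal (affinePoint k α).toSubring ^ N := by
    have h3 : localEval x (S.truncTotal N - MvPolynomial.monomial e c -
        ∑ i, q i * MvPolynomial.X i ^ a) =
        ∑ i, (z i - localEval x (q i)) * x i ^ a - (g - localEval x (S.truncTotal N)) := by
      simp only [he, map_sub, map_mul, map_sum, map_prod, map_pow, localEval_X, localEval_C,
        sub_mul, Finset.sum_sub_distrib, hz]
      ring
    rw [h3]
    exact sub_mem (sum_mem fun i _ => Ideal.mul_mem_right _ _ (hq i)) h1
  have h3 := (MvPolynomial.mem_pow_idealOfVars_iff' _ _).1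
    (mem_pow_idealOfVars_of_localEval_mem hx h2) e (Nat.lt_succ_self _)
  rw [MvPolynomial.coeff_sub, MvPolynomial.coeff_sub,
    MvPowerSeries.coeff_truncTotal _ (Nat.lt_succ_self _), MvPolynomial.coeff_monomial, if_pos rfl,
    MvPolynomial.coeff_sum, Finset.sum_eq_zero, sub_zero, sub_eq_zero] at h3
  · exact h3
  · intro i _
    rw [MvPolynomial.X_pow_eq_monomial, MvPolynomial.coeff_mul_monomial', if_neg]
    intro hle
    have h4 := hle i
    rw [Finsupp.single_eq_same] at h4
    have h5 : e i = a - 1 := rfl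
    omega

/-- Multiplying `∏ x j ^ (a - 1)` by any `x i` lands in the ideal of `a`-th powers, so only the
value of `v` at the point matters. -/
theorem mul_sub_mem_span_pow {R : Type*} [CommRing R] {x : Fin r → R} {a : ℕ} (ha : 0 < a)
    {w c v v₀ : R} (hw : w - c * ∏ j, x j ^ (a - 1) ∈ Ideal.span (Set.range fun i => x i ^ a))
    (hv : v - v₀ ∈ Ideal.span (Set.range x)) :
    v * w - v₀ * c * ∏ j, x j ^ (a - 1) ∈ Ideal.span (Set.range fun i => x i ^ a) := by
  have e : v * w - v₀ * c * ∏ j, x j ^ (a - 1) =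
      v * (w - c * ∏ j, x j ^ (a - 1)) + c * ((v - v₀) * ∏ j, x j ^ (a - 1)) := by ring
  rw [e]
  refine add_mem (Ideal.mul_mem_left _ _ hw) (Ideal.mul_mem_left _ _ ?_)
  rw [Ideal.mem_span_range_iff_exists_fun] at hv
  obtain ⟨t, ht⟩ := hv
  rw [← ht, Finset.sum_mul]
  refine sum_mem fun i _ => ?_
  have h1 : t i * x i * ∏ j, x j ^ (a - 1) =
      t i * (∏ j ∈ Finset.univ.erase i, x j ^ (a - 1)) * x i ^ a := by
    rw [← Finset.mul_prod_erase _ _ (Finset.mem_univ i)]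
    obtain ⟨b, rfl⟩ := Nat.exists_eq_add_of_lt ha
    simp only [zero_add, Nat.add_sub_cancel]
    ring
  rw [h1]
  exact Ideal.mul_mem_left _ _ (Ideal.subset_span ⟨i, rfl⟩)

end Expansions

/-! ### Strictly rectified differential codes as weighted evaluation codes. -/

section Residues

variable {k : Type*} [Field k] {r : ℕ}

/-- The function `h` of the form is `V * θ`, where `V` has value `b` times the value of `p`. Since
`det [r_ij] * θ` is `c * ∏ x j ^ (a - 1)` modulo the `a`-th powers, multiplication by `V` only
scales the leading coefficient. -/
theorem hasResidue_iff [Finite k] {α : Fin r → k} {D : Fin r → Divisor (P1Pow k r)}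
    (F : LocalChoice D (affinePoint k α)) {θ : FunField k r} (hθ0 : θ ≠ 0)
    (hθ : θ ∈ (affinePoint k α).toSubring) {c : k}
    (hc : ∃ z ∈ F.powIdeal, (F.mat.det : FunField k r) * θ -
      algebraMap k _ c * ∏ j, (F.x j : FunField k r) ^ (F.a - 1) = (z : FunField k r))
    {u : FunField k r} (hu0 : u ≠ 0)
    (hu : wedgeD k (fun i => (F.x i : FunField k r)) = u • wedgeD k (coord k))
    {H : FunField k r} (hH : H ≠ 0) {b : k}
    (hb : HasValue k (affinePoint k α) ((∏ l, (F.f l : FunField k r)) / (H * θ * u)) b)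
    (p : MvPolynomial (Fin r) k) (v : k) :
    HasResidue k F ((affineMap p / H) • wedgeD k (coord k)) v ↔
      v = b * c * MvPolynomial.eval α p := by
  set U := (∏ l, (F.f l : FunField k r)) / (H * θ * u)
  have hbp := hb.mul (hasValue_affineMap α p)
  let V : (affinePoint k α).toSubring := ⟨U * affineMap p, hbp.mem⟩
  let T : (affinePoint k α).toSubring := ⟨θ, hθ⟩
  have hform : (∏ l, (F.f l : FunField k r)) • (affineMap p / H) • wedgeD k (coord k) =
      ((V * T : (affinePoint k α).toSubring) : FunField k r) •
        wedgeD k (fun i => (F.x i : FunField k r)) := by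
    rw [hu, smul_smul, smul_smul]
    congr 1
    change _ = U * affineMap p * θ * u
    simp only [U]
    field_simp
  have hmem : F.mat.det * (V * T) - constHom k α (b * c * MvPolynomial.eval α p) *
      ∏ j, F.x j ^ (F.a - 1) ∈ Ideal.span (Set.range fun i => F.x i ^ F.a) := by
    obtain ⟨z, hz, e⟩ := hc
    have h1 : F.mat.det * T - constHom k α c * ∏ j, F.x j ^ (F.a - 1) ∈
        Ideal.span (Set.range fun i => F.x i ^ F.a) := by
      have h2 : F.mat.det * T - constHom k α c * ∏ j, F.x j ^ (F.a - 1) = z := by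
        apply Subtype.ext
        rw [← e]
        simp [T, constHom]
      rw [h2]
      exact hz
    have h2 : V - constHom k α (b * MvPolynomial.eval α p) ∈ Ideal.span (Set.range F.x) := by
      rw [F.span_x]
      exact (vanishes_coe (z := V - constHom k α _)).1 hbp
    convert mul_sub_mem_span_pow F.a_pos h1 h2 using 1
    simp only [map_mul]
    ring
  constructor
  · rintro ⟨h, hω, S, hS, rfl⟩
    rw [hform, hu, smul_smul, smul_smul] at hω
    have h1 : V * T = h := Subtype.ext (mul_right_cancel₀ hu0 (smul_wedgeD_injective hω))
    rw [← h1] at hS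
    exact coeff_expansion_eq F.span_x F.a_pos hmem hS
  · rintro rfl
    obtain ⟨S, hS⟩ := exists_hasExpansion F.span_x (F.mat.det * (V * T))
    exact ⟨V * T, hform, S, hS, coeff_expansion_eq F.span_x F.a_pos hmem hS⟩

theorem differentialCode_eq [Fintype k] {G : Divisor (P1Pow k r)}
    {D : Fin r → Divisor (P1Pow k r)} (hpts : ∀ α, affinePoint k α ∈ inter D)
    (F : ∀ P : inter D, LocalChoice D P.1) {θ : FunField k r}
    (hG : ∀ α, ¬ InSupport G (affinePoint k α))
    (hθ : StrictlyRectifying k (affinePoint k) F θ) :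
    ∃ (n : Fin r → ℤ) (w : (Fin r → k) → k), (∀ α, w α ≠ 0) ∧
      differentialCode k (affinePoint k) hpts F θ G =
        {v | ∃ p ∈ polySpace k n, ∀ α, v α = w α * MvPolynomial.eval α p} := by
  obtain ⟨hθ0, hθmem, hθc, -⟩ := hθ
  obtain ⟨H₁, hH₁, hW₁⟩ := exists_ord_eq_divisor (∑ l, D l - G)
  obtain ⟨H₂, hH₂, hW₂⟩ := exists_ord_eq_max hθ0
  have hH : H₁ / H₂ ≠ 0 := div_ne_zero hH₁ hH₂
  have hW : ∀ Y : PrimeDivisor (P1Pow k r), Y.IsAffine →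
      Y.ord (H₁ / H₂) = ∑ l, D l Y - G Y - max (Y.ord θ) 0 := fun Y hY => by
    rw [Y.ord_div hH₁ hH₂, hW₁ Y hY, hW₂ Y hY, Finsupp.sub_apply, Finsupp.finsetSum_apply]
  obtain ⟨n, hn⟩ := exists_formSpace_iff hH hW
  have hres : ∀ α, ∃ w : k, w ≠ 0 ∧ ∀ p v,
      HasResidue k (F ⟨affinePoint k α, hpts α⟩)
        ((affineMap p / (H₁ / H₂)) • wedgeD k (coord k)) v ↔ v = w * MvPolynomial.eval α p := by
    intro α
    let F' : LocalChoice D (affinePoint k α) := F ⟨affinePoint k α, hpts α⟩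
    obtain ⟨u, hu0, hu, hu', huw⟩ := exists_wedgeD_localParameters F'.x F'.span_x
    obtain ⟨c, hc0, hc⟩ := hθc ⟨affinePoint k α, hpts α⟩ ⟨α, rfl⟩
    have hf : ∀ l, (F'.f l : FunField k r) ≠ 0 := fun l h => F'.f_ne_zero l (Subtype.ext h)
    have hprod := Finset.prod_ne_zero_iff.2 fun l (_ : l ∈ Finset.univ) => hf l
    have hU0 : (∏ l, (F'.f l : FunField k r)) / (H₁ / H₂ * θ * u) ≠ 0 :=
      div_ne_zero hprod (mul_ne_zero (mul_ne_zero hH hθ0) hu0)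
    have hθα : θ ∈ (affinePoint k α).toSubring := hθmem ⟨affinePoint k α, hpts α⟩
    -- Along a divisor through the point the order is `∑ D_l - (∑ D_l - G - (θ)⁺) - (θ)`. The part
    -- from `θ` cancels because `θ` is regular there, and `G` vanishes there; the Jacobian `u` is a
    -- unit.
    have hU := unit_of_ord_eq_zero
      (f := (∏ l, (F'.f l : FunField k r)) / (H₁ / H₂ * θ * u)) (α := α) fun Y hY hP => by
        rw [Y.ord_div hprod (mul_ne_zero (mul_ne_zero hH hθ0) hu0),
          Y.ord_mul (mul_ne_zero hH hθ0) hu0, Y.ord_mul hH hθ0, hW Y hY,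
          Y.ord_prod _ _ fun l _ => hf l,
          Finset.sum_congr rfl fun l _ => F'.ord_f l Y hP,
          eq_zero_of_not_inSupport (hG α) hP, Y.ord_eq_zero_of_mem (hP hu) (hP hu'),
          max_eq_left (Y.ord_nonneg_of_mem (hP hθα))]
        ring
    obtain ⟨b, hb0, hb⟩ := exists_hasValue_of_unit hU0 hU.1 hU.2
    exact ⟨b * c, mul_ne_zero hb0 hc0, hasResidue_iff F' hθ0 hθα hc hu0 huw hH hb⟩
  choose w hw0 hw using hres
  refine ⟨n, w, hw0, ?_⟩
  ext v
  constructor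
  · rintro ⟨ω, hω, hv⟩
    obtain ⟨g, rfl⟩ := exists_eq_smul_wedgeD ω
    obtain ⟨p, hp, rfl⟩ := (hn g).1 hω
    exact ⟨p, hp, fun α => (hw α p _).1 (hv α)⟩
  · rintro ⟨p, hp, hv⟩
    exact ⟨_, (hn _).2 ⟨p, hp, rfl⟩, fun α => (hw α p _).2 (hv α)⟩

end Residues

end RectifiedCodes

open RectifiedCodes in
theorem mainTheorem7 (k : Type*) [Field k] [Fintype k] (r : ℕ) (hr : 2 ≤ r) (m : Fin r → ℕ)
    (hm : ∀ i, m i + 2 < Fintype.card k) :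
    ¬ IsFunctionalCode k (P1Pow k r) (affinePoint k)
        (dualCode (functionalCode k (affinePoint k)
          (∑ i, Finsupp.single (polarDivisor k i) (m i : ℤ)))) ∧
    ¬ IsStrictlyRectifiedCode k r (P1Pow k r) (affinePoint k)
        (dualCode (functionalCode k (affinePoint k)
          (∑ i, Finsupp.single (polarDivisor k i) (m i : ℤ)))) := by
  refine ⟨not_isFunctionalCode_dualCode hr hm, ?_⟩
  rintro ⟨G, D, hpts, F, θ, hG, -, hθ, h⟩
  obtain ⟨n, w, hw, hGeq⟩ := differentialCode_eq hpts F hG hθ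
  exact dualCode_functionalCode_ne hr hm n w hw (h.trans hGeq)
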